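/- **Setting.** States are real numbers, actions lie in a nonempty compact set $A\subset\mathbb R$, and the dynamics are $S'=f_\theta(S,A)+\varepsilon$ with $\varepsilon\sim\mathcal N(0,\sigma_\theta^2)$, $\sigma_\theta^2>0$, where the parameter $\theta$, standing for $(f_\theta,\sigma^2_\theta)$, ranges over a metric space $(\Theta,d)$ with its Borel $\sigma$-algebra, $f_\theta\in C(\mathbb R\times A)$, and $\theta\mapsto f_\theta(s,a)$, $\theta\mapsto\sigma_\theta^2$ are measurable. Write $p(\cdot\mid s,a;\theta)=\mathcal N(f_\theta(s,a),\sigma_\theta^2)$. Let $\theta_0\in\Theta$ be the true parameter, and assume that at $\theta_0$ the maps $\theta\mapsto f_\theta$ (for locally uniform convergence on $\mathbb R\times A$) and $\theta\mapsto\sigma^2_\theta$ are continuous. Let $\pi$ be a prior probability measure on $\Theta$, and let the data $\mathcal D^n=\{(s_i,a_i,s_i')\}_{i<n}$ be random with law $P_{\theta_0}$: $s_i'=f_{\theta_0}(s_i,a_i)+\varepsilon_i$, where $\varepsilon_i\sim\mathcal N(0,\sigma_{\theta_0}^2)$ is independent of $(s_j,a_j)_{j\le i}$ and $(s'_j)_{j<i}$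 (so the pairs $(s_i,a_i)$ may depend on the past). Let $\pi_n$ be the posterior, $\pi_n(B)\propto\int_B\prod_{i<n}p(s_i'\mid s_i,a_i;\theta)\,\pi(d\theta)$. For a belief (probability measure) $b$ on $\Theta$ let $p_b(\cdot\mid s,a)=\int p(\cdot\mid s,a;\theta)\,b(d\theta)$ be the posterior predictive transition, let $b^{s,a,s'}(d\theta)\propto p(s'\mid s,a;\theta)\,b(d\theta)$ be the updated belief, and let the information gain $\mathrm{IG}_b(s,a)=I(\theta;S'\mid s,a)$ be the mutual information between $\theta\sim b$ and $S'\sim p(\cdot\mid s,a;\theta)$. Let $r^e:\mathbb R\times A\to\mathbb R$ be measurable, bounded, and continuous in the action, let $\eta\ge0$ and $\gamma\in(0,1)$, and assume that the intrinsic part of the reward is bounded: $\sup_{b,s,a}\eta\,\mathrm{IG}_b(s,a)<\infty$, over all $s$, $a$ and all beliefs $b$ absolutely continuous with respect to $\pi$. With $t$ steps to go define $V^{*,augm}_0=V^*_0=0$ and $$V^{*,augm}_{t+1}(s,b)=\sup_{a\in A}\Big[r^e(s,a)+\eta\,\mathrm{IG}_b(s,a)+\gamma\int V^{*,augm}_{t}(s',b^{s,a,s'})\,p_b(ds'\mid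 s,a)\Big],$$ $$V^{*}_{t+1}(s;\theta_0)=\sup_{a\in A}\Big[r^e(s,a)+\gamma\int V^{*}_{t}(s';\theta_0)\,p(ds'\mid s,a;\theta_0)\Big].$$ **Statement.** Suppose that the posterior is weakly consistent at $\theta_0$: for every $\epsilon>0$, $\pi_n(\{\theta: d(\theta,\theta_0)>\epsilon\})\to0$ in $P_{\theta_0}$-probability as $n\to\infty$. Then for every horizon $t\in\mathbb N$ and every state $s$, $$V^{*,augm}_t(s,\pi_n)\longrightarrow V^*_t(s;\theta_0)\quad\text{in }P_{\theta_0}\text{-probability as }n\to\infty.$$ -/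

import Mathlib

open MeasureTheory ProbabilityTheory Filter Topology
open scoped ENNReal NNReal

noncomputable section

namespace BayesRL

/-- Additive Gaussian noise dynamics `S' = f_θ(S, A) + ε`, `ε ∼ N(0, σ²_θ)`, with states in `ℝ` and
actions in `A ⊆ ℝ`, indexed by a parameter `θ ∈ Θ`, which stands for the pair `(f_θ, σ²_θ)`. -/
structure Dynamics (A : Set ℝ) (Θ : Type*) [MeasurableSpace Θ] where
  /-- the regression function `f_θ` -/
  f : Θ → C(ℝ × A, ℝ)
  /-- the noise variance `σ²_θ` -/
  var : Θ → ℝ≥0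
  var_pos : ∀ θ, 0 < var θ
  measurable_f : ∀ x, Measurable (fun θ => f θ x)
  measurable_var : Measurable var

variable {A : Set ℝ} {Θ : Type*} [MeasurableSpace Θ]

/-- The transition kernel `θ ↦ p(· | s, a; θ) = N(f_θ(s, a), σ²_θ)` at a state-action pair. -/
def Dynamics.transition (M : Dynamics A Θ) (s : ℝ) (a : A) : Kernel Θ ℝ where
  toFun θ := gaussianReal (M.f θ (s, a)) (M.var θ)
  measurable' :=
    measurable_gaussianReal.comp ((M.measurable_f (s, a)).prodMk M.measurable_var)

/-- The density `p(s' | s, a; θ)` of the observed transition `(s, a, s')`, as a function of `θ`. -/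
def Dynamics.likelihood (M : Dynamics A Θ) (x : ℝ × A) (s' : ℝ) (θ : Θ) : ℝ≥0∞ :=
  gaussianPDF (M.f θ x) (M.var θ) s'

/-- Bayes' rule: the belief `B ↦ ∫_B L db / ∫ L db` obtained from the belief `b` and the
likelihood function `L`. -/
def bayes (b : Measure Θ) (L : Θ → ℝ≥0∞) : Measure Θ :=
  (∫⁻ θ, L θ ∂b)⁻¹ • b.withDensity L

/-- The posterior given the prior and the first `n` transitions `(x_i, y_i) = ((s_i, a_i), s_i')`. -/
def Dynamics.posterior (M : Dynamics A Θ) (prior : Measure Θ) (x : ℕ → ℝ × A) (y : ℕ → ℝ)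
    (n : ℕ) : Measure Θ :=
  bayes prior (fun θ => ∏ i ∈ Finset.range n, M.likelihood (x i) (y i) θ)

/-- The posterior predictive transition `p_b(· | s, a) = ∫ p(· | s, a; θ) b(dθ)`. -/
def Dynamics.predictive (M : Dynamics A Θ) (b : Measure Θ) (s : ℝ) (a : A) : Measure ℝ :=
  b.bind (M.transition s a)

/-- The information gain under the belief `b`: the mutual information `I(θ ; S' | s, a)` between the
parameter `θ ∼ b` and the next state `S' ∼ p(· | s, a; θ)`, i.e. the Kullback-Leibler divergence of
the joint law from the product of its marginals. -/
def Dynamics.infoGain (M : Dynamics A Θ) (b : Measure Θ) (s : ℝ) (a : A) : ℝ≥0∞ :=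
  InformationTheory.klDiv (b ⊗ₘ M.transition s a) (b.prod (M.predictive b s a))

/-- The optimal value, with `t` steps to go, of the Bayes-adaptive problem with augmented reward
`r^e + η · IG`. The hyper-state is `(s, b)` with `b` the current belief; after `(s, a, s')` the new
state is `s'`, drawn from the posterior predictive, and the belief is updated by Bayes' rule. -/
def Dynamics.Vaugm (M : Dynamics A Θ) (r : ℝ → A → ℝ) (η γ : ℝ) : ℕ → ℝ → Measure Θ → ℝ
  | 0, _, _ => 0
  | t + 1, s, b => ⨆ a : A, (r s a + η * (M.infoGain b s a).toReal +
      γ * ∫ s', Dynamics.Vaugm M r η γ t s' (bayes b (M.likelihood (s, a) s'))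
        ∂(M.predictive b s a))

/-- The optimal value, with `t` steps to go, of the MDP with reward `r^e` and known dynamics
parameter `θ`. -/
def Dynamics.Vstar (M : Dynamics A Θ) (r : ℝ → A → ℝ) (γ : ℝ) (θ : Θ) : ℕ → ℝ → ℝ
  | 0, _ => 0
  | t + 1, s => ⨆ a : A, (r s a +
      γ * ∫ s', Dynamics.Vstar M r γ θ t s' ∂(M.transition s a θ))

/-- Under `P` the transitions `(X_i, Y_i) = ((s_i, a_i), s_i')` follow the model with parameter `θ₀`:
`Y_i = f_{θ₀}(X_i) + ε_i` with `ε_i ∼ N(0, σ²_{θ₀})` independent of the current state-action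
pair and of all the past. The pairs `X_i` may depend on the past in any way, as along a trajectory
`s_{i+1} = s_i'` of any policy. -/
structure Dynamics.IsTrueModel (M : Dynamics A Θ) (θ₀ : Θ) {Ω : Type*} [MeasurableSpace Ω]
    (P : Measure Ω) (X : ℕ → Ω → ℝ × A) (Y : ℕ → Ω → ℝ) : Prop where
  measurable_X : ∀ i, Measurable (X i)
  measurable_Y : ∀ i, Measurable (Y i)
  noise_law : ∀ i, P.map (fun ω => Y i ω - M.f θ₀ (X i ω)) = gaussianReal 0 (M.var θ₀)
  noise_indep : ∀ i, IndepFun (fun ω => Y i ω - M.f θ₀ (X i ω))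
    (fun ω => ((fun j : Fin (i + 1) => X j ω), (fun j : Fin i => Y j ω))) P

end BayesRL

end

/-! Weak consistency makes the dispersion of the posterior, the mean of `min 1 (edist θ θ₀)`, tend
to 0 in probability. The core of the proof, `tendsto_Vaugm`, is deterministic: along any sequence of
beliefs with densities with respect to the prior and dispersion tending to 0, the augmented value
tends to `Vstar`. It goes by induction on the horizon and rests on three facts.

Information gain vanishes (`tendsto_infoGain`). Mutual information is at most the mean divergence of
`p(· | θ)` from any reference density. The reference is a mixture of the true transition density,
which serves the parameters near `θ₀`, and of the predictive density of the belief conditioned on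
the far set. The near part costs little. The far part costs the small far mass times an information
gain, which the boundedness assumption controls.

Concentration survives an update (`exists_subseq_update`). By Scheffé the predictive density tends
to the true one in `L¹`. The updated dispersion averages, under the predictive law, to the current
one. Along a subsequence both converge for almost every next state, where the induction hypothesis
applies. Fixed actions then bound the limit of the values from below, and compactness of `A` bounds
it from above.

Integrals of values are meaningful. A supremum over uncountably many actions need not be measurable,
and the Bochner integral of a nonmeasurable function is 0. Measurability is therefore proved
together with lower semicontinuity in the density of the belief
(`isMeasurableValue_and_isLscValue`), which reduces the supremum to a countable dense set of
actions.

The data enter last: the posterior almost surely has a density with respect to the prior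
(`ae_posterior_eq`), and the sequential limit becomes an ε-δ statement (`exists_dispersion_bound`)
that transfers convergence in probability. -/

noncomputable section

namespace BayesRL

variable {A : Set ℝ} {Θ : Type*} [MeasurableSpace Θ]

/-! ### Convergence in `L¹` of `ℝ≥0∞`-valued functions -/

section Scheffe

/-- The distance `|a - b|` on `ℝ≥0∞`. -/
def gap (a b : ℝ≥0∞) : ℝ≥0∞ := (a - b) + (b - a)

lemma le_add_gap (a b : ℝ≥0∞) : a ≤ b + gap a b := by
  unfold gap
  calc a ≤ b + (a - b) := le_add_tsub
    _ ≤ _ := by gcongr; exact le_self_add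

lemma gap_comm (a b : ℝ≥0∞) : gap a b = gap b a := add_comm _ _

lemma gap_le_add (a b : ℝ≥0∞) : gap a b ≤ a + b := add_le_add tsub_le_self tsub_le_self

@[fun_prop]
lemma measurable_gap {α : Type*} [MeasurableSpace α] {f g : α → ℝ≥0∞} (hf : Measurable f)
    (hg : Measurable g) : Measurable (fun x => gap (f x) (g x)) :=
  (hf.sub hg).add (hg.sub hf)

lemma tendsto_of_gap_tendsto_zero {ι : Type*} {l : Filter ι} {u : ι → ℝ≥0∞} {x : ℝ≥0∞}
    (h : Tendsto (fun i => gap (u i) x) l (𝓝 0)) (hx : x ≠ ∞) : Tendsto u l (𝓝 x) := by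
  have h1 : Tendsto (fun i => x - gap (u i) x) l (𝓝 x) := by
    simpa using ENNReal.Tendsto.sub (tendsto_const_nhds (x := x)) h (Or.inl hx)
  have h2 : Tendsto (fun i => x + gap (u i) x) l (𝓝 x) := by
    simpa using (tendsto_const_nhds (x := x)).add h
  refine tendsto_of_tendsto_of_tendsto_of_le_of_le h1 h2 (fun i => ?_) (fun i => le_add_gap _ _)
  rw [tsub_le_iff_right, gap_comm]
  exact le_add_gap _ _

variable {α : Type*} [MeasurableSpace α] {μ : Measure α}

/-- **Scheffé's lemma**: densities that converge almost everywhere converge in `L¹`. -/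
lemma tendsto_lintegral_gap {ι : Type*} {l : Filter ι} [l.IsCountablyGenerated]
    {F : ι → α → ℝ≥0∞} {f : α → ℝ≥0∞} (hF : ∀ i, Measurable (F i)) (hf : Measurable f)
    (hF1 : ∀ i, ∫⁻ x, F i x ∂μ = 1) (hf1 : ∫⁻ x, f x ∂μ = 1)
    (hlim : ∀ᵐ x ∂μ, Tendsto (fun i => F i x) l (𝓝 (f x))) :
    Tendsto (fun i => ∫⁻ x, gap (F i x) (f x) ∂μ) l (𝓝 0) := by
  have hfin : ∀ᵐ x ∂μ, f x < ∞ := ae_lt_top hf (by simp [hf1])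
  have h1 : Tendsto (fun i => ∫⁻ x, (f x - F i x) ∂μ) l (𝓝 (∫⁻ _, 0 ∂μ)) := by
    refine tendsto_lintegral_filter_of_dominated_convergence f
      (Eventually.of_forall fun i => hf.sub (hF i))
      (Eventually.of_forall fun i => ae_of_all _ fun x => tsub_le_self) (by simp [hf1]) ?_
    filter_upwards [hlim, hfin] with x hx hx'
    simpa using ENNReal.Tendsto.sub (tendsto_const_nhds (x := f x)) hx (Or.inl hx'.ne)
  -- Only `f - F i` has an integrable majorant, namely `f`. Equal total masses give the other half
  -- of the gap the same integral.
  have h2 : ∀ i, ∫⁻ x, (F i x - f x) ∂μ = ∫⁻ x, (f x - F i x) ∂μ := by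
    intro i
    have h : ∫⁻ x, F i x + (f x - F i x) ∂μ = ∫⁻ x, f x + (F i x - f x) ∂μ := by
      congr 1
      funext x
      rcases le_total (F i x) (f x) with h | h
      · rw [add_tsub_cancel_of_le h, tsub_eq_zero_of_le h, add_zero]
      · rw [add_tsub_cancel_of_le h, tsub_eq_zero_of_le h, add_zero]
    rw [lintegral_add_left (hF i), lintegral_add_left hf, hF1, hf1] at h
    exact ((ENNReal.add_right_inj ENNReal.one_ne_top).1 h).symm
  have h3 : ∀ i, ∫⁻ x, gap (F i x) (f x) ∂μ
      = ∫⁻ x, (f x - F i x) ∂μ + ∫⁻ x, (f x - F i x) ∂μ := by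
    intro i
    calc ∫⁻ x, gap (F i x) (f x) ∂μ = ∫⁻ x, (F i x - f x) ∂μ + ∫⁻ x, (f x - F i x) ∂μ :=
          lintegral_add_left ((hF i).sub hf) _
      _ = _ := by rw [h2]
  simp only [h3]
  simpa using h1.add h1

/-- A sequence that converges to `0` in `L¹` has a subsequence converging almost everywhere. -/
lemma exists_subseq_tendsto_zero_ae {u : ℕ → α → ℝ≥0∞} (hu : ∀ n, Measurable (u n))
    (h : Tendsto (fun n => ∫⁻ x, u n x ∂μ) atTop (𝓝 0)) :
    ∃ φ : ℕ → ℕ, StrictMono φ ∧ ∀ᵐ x ∂μ, Tendsto (fun k => u (φ k) x) atTop (𝓝 0) := by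
  have hev : ∀ k : ℕ, ∀ᶠ n in atTop, ∫⁻ x, u n x ∂μ < (2⁻¹ : ℝ≥0∞) ^ k := fun k =>
    h.eventually_lt_const (by simp [ENNReal.pow_pos])
  obtain ⟨φ, hφ, hφ'⟩ := extraction_forall_of_eventually' (fun k => (hev k).exists_forall_of_atTop)
  refine ⟨φ, hφ, ?_⟩
  have hsum : ∫⁻ x, ∑' k, u (φ k) x ∂μ ≠ ∞ := by
    rw [lintegral_tsum fun k => (hu _).aemeasurable]
    refine ne_top_of_le_ne_top ?_ (ENNReal.tsum_le_tsum fun k => (hφ' k).le)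
    rw [ENNReal.tsum_geometric]
    simp
  filter_upwards [ae_lt_top (Measurable.tsum fun k => hu (φ k)) hsum] with x hx
  exact ENNReal.tendsto_atTop_zero_of_tsum_ne_top hx.ne

lemma gap_lintegral_le {f g : α → ℝ≥0∞} (hf : Measurable f) (hg : Measurable g) :
    gap (∫⁻ x, f x ∂μ) (∫⁻ x, g x ∂μ) ≤ ∫⁻ x, gap (f x) (g x) ∂μ := by
  calc gap (∫⁻ x, f x ∂μ) (∫⁻ x, g x ∂μ) ≤ ∫⁻ x, (f x - g x) ∂μ + ∫⁻ x, (g x - f x) ∂μ :=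
        add_le_add (lintegral_sub_le _ _ hg) (lintegral_sub_le _ _ hf)
    _ = ∫⁻ x, gap (f x) (g x) ∂μ := (lintegral_add_left (hf.sub hg) _).symm

/-- If joint densities converge almost everywhere then their marginals converge almost everywhere
along a subsequence. -/
lemma exists_subseq_tendsto_marginal {β : Type*} [MeasurableSpace β] {ν : Measure β} [SFinite ν]
    [SFinite μ] {h : ℕ → α → β → ℝ≥0∞} {h' : α → β → ℝ≥0∞}
    (hm : ∀ n, Measurable (Function.uncurry (h n))) (hm' : Measurable (Function.uncurry h'))
    (h1 : ∀ n, ∫⁻ x, ∫⁻ y, h n x y ∂ν ∂μ = 1) (h1' : ∫⁻ x, ∫⁻ y, h' x y ∂ν ∂μ = 1)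
    (hlim : ∀ᵐ x ∂μ, ∀ᵐ y ∂ν, Tendsto (fun n => h n x y) atTop (𝓝 (h' x y))) :
    ∃ φ : ℕ → ℕ, StrictMono φ ∧ ∀ᵐ x ∂μ,
      Tendsto (fun k => ∫⁻ y, h (φ k) x y ∂ν) atTop (𝓝 (∫⁻ y, h' x y ∂ν)) := by
  -- Scheffé on the product space replaces a domination in `y`; marginalizing does not increase the
  -- `L¹` distance.
  have hprod : Tendsto (fun n => ∫⁻ z, gap (h n z.1 z.2) (h' z.1 z.2) ∂(μ.prod ν)) atTop (𝓝 0) := by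
    refine tendsto_lintegral_gap hm hm' (fun n => ?_) ?_ ?_
    · exact (lintegral_prod _ (hm n).aemeasurable).trans (h1 n)
    · exact (lintegral_prod _ hm'.aemeasurable).trans h1'
    · have hs : MeasurableSet {z : α × β | Tendsto (fun n => h n z.1 z.2) atTop
          (𝓝 (h' z.1 z.2))} := measurableSet_tendsto_fun hm hm'
      exact (Measure.ae_prod_iff_ae_ae hs).2 hlim
  have hmarg : Tendsto (fun n => ∫⁻ x, gap (∫⁻ y, h n x y ∂ν) (∫⁻ y, h' x y ∂ν) ∂μ) atTop
      (𝓝 0) := by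
    refine tendsto_of_tendsto_of_tendsto_of_le_of_le tendsto_const_nhds hprod
      (fun _ => zero_le) (fun n => ?_)
    have : Measurable (fun z : α × β => gap (h n z.1 z.2) (h' z.1 z.2)) := measurable_gap (hm n) hm'
    rw [lintegral_prod _ this.aemeasurable]
    refine lintegral_mono fun x => gap_lintegral_le ?_ ?_
    · exact (hm n).comp measurable_prodMk_left
    · exact hm'.comp measurable_prodMk_left
  obtain ⟨φ, hφ, hae⟩ := exists_subseq_tendsto_zero_ae
    (fun n => measurable_gap (hm n).lintegral_prod_right' hm'.lintegral_prod_right') hmarg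
  have hfin : ∀ᵐ x ∂μ, ∫⁻ y, h' x y ∂ν < ∞ :=
    ae_lt_top hm'.lintegral_prod_right' (by simp [h1'])
  refine ⟨φ, hφ, ?_⟩
  filter_upwards [hae, hfin] with x hx hx'
  exact tendsto_of_gap_tendsto_zero hx hx'.ne

/-- If the measures `b n` concentrate at `θ₀`, then integrals of bounded functions `T n` that vanish
as `(n, θ) → (∞, θ₀)` tend to `0`. -/
lemma tendsto_lintegral_of_concentrate {Θ : Type*} [MetricSpace Θ] [MeasurableSpace Θ]
    [BorelSpace Θ] {θ₀ : Θ} {b : ℕ → Measure Θ} [∀ n, IsProbabilityMeasure (b n)]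
    (hb : Tendsto (fun n => ∫⁻ θ, min 1 (edist θ θ₀) ∂(b n)) atTop (𝓝 0))
    {T : ℕ → Θ → ℝ≥0∞} {C : ℝ≥0∞} (hC : C ≠ ∞) (hTC : ∀ n θ, T n θ ≤ C)
    (hT : Tendsto (fun p : ℕ × Θ => T p.1 p.2) (atTop ×ˢ 𝓝 θ₀) (𝓝 0)) :
    Tendsto (fun n => ∫⁻ θ, T n θ ∂(b n)) atTop (𝓝 0) := by
  rw [ENNReal.tendsto_nhds_zero] at hT ⊢
  intro ε hε
  have hε2 : 0 < ε / 2 := ENNReal.half_pos hε.ne'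
  obtain ⟨pa, hpa, pb, hpb, hab⟩ := eventually_prod_iff.1 (hT (ε / 2) hε2)
  obtain ⟨δ, hδ, hball⟩ := EMetric.mem_nhds_iff.1 hpb
  -- Outside the `δ`-ball the cut-off distance is at least `min 1 δ`, so `C / δ'` times it dominates
  -- `C`, as in Markov's inequality.
  set δ' : ℝ≥0∞ := min 1 δ with hδ'
  have hδ'0 : δ' ≠ 0 := by simp [δ', hδ.ne']
  have hδ't : δ' ≠ ∞ := by simp [δ']
  have hlim : Tendsto (fun n => C / δ' * ∫⁻ θ, min 1 (edist θ θ₀) ∂(b n)) atTop (𝓝 0) := by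
    simpa using ENNReal.Tendsto.const_mul hb (Or.inr (ENNReal.div_ne_top hC hδ'0))
  filter_upwards [hpa, (ENNReal.tendsto_nhds_zero.1 hlim) (ε / 2) hε2] with n hn hn'
  have hpt : ∀ θ, T n θ ≤ ε / 2 + C / δ' * min 1 (edist θ θ₀) := by
    intro θ
    by_cases hθ : edist θ θ₀ < δ
    · exact (hab hn (hball hθ)).trans le_self_add
    · have : δ' ≤ min 1 (edist θ θ₀) := min_le_min le_rfl (not_lt.1 hθ)
      calc T n θ ≤ C := hTC n θ
        _ = C / δ' * δ' := (ENNReal.div_mul_cancel hδ'0 hδ't).symm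
        _ ≤ C / δ' * min 1 (edist θ θ₀) := by gcongr
        _ ≤ _ := le_add_self
  have hmeas : Measurable (fun θ => min 1 (edist θ θ₀)) :=
    measurable_const.min (by fun_prop)
  calc ∫⁻ θ, T n θ ∂(b n) ≤ ∫⁻ θ, (ε / 2 + C / δ' * min 1 (edist θ θ₀)) ∂(b n) := lintegral_mono hpt
    _ = ε / 2 + C / δ' * ∫⁻ θ, min 1 (edist θ θ₀) ∂(b n) := by
        rw [lintegral_add_left measurable_const, lintegral_const_mul _ hmeas]; simp
    _ ≤ ε / 2 + ε / 2 := by gcongr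
    _ = ε := ENNReal.add_halves ε

end Scheffe

/-! ### The pointwise Kullback-Leibler divergence of densities -/

section Bregman

open InformationTheory Real

/-- The integrand `x log (x / q) + q - x` of the Kullback-Leibler divergence between measures with
densities `x` and `q`. -/
def bregman (x q : ℝ≥0∞) : ℝ≥0∞ := q * ENNReal.ofReal (klFun (x / q).toReal)

@[fun_prop]
lemma measurable_bregman {α : Type*} [MeasurableSpace α] {f g : α → ℝ≥0∞} (hf : Measurable f)
    (hg : Measurable g) : Measurable (fun x => bregman (f x) (g x)) := by
  unfold bregman
  have := measurable_klFun
  fun_prop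

lemma bregmanReal_nonneg {x q : ℝ} (hx : 0 < x) (hq : 0 < q) :
    0 ≤ x * log x - x * log q + q - x := by
  have h := klFun_nonneg (div_pos hx hq).le
  have : x * log x - x * log q + q - x = q * klFun (x / q) := by
    rw [klFun_apply, log_div hx.ne' hq.ne']; field_simp
  rw [this]
  exact mul_nonneg hq.le h

lemma bregman_ofReal {x q : ℝ} (hx : 0 < x) (hq : 0 < q) :
    bregman (ENNReal.ofReal x) (ENNReal.ofReal q)
      = ENNReal.ofReal (x * log x - x * log q + q - x) := by
  unfold bregman
  rw [← ENNReal.ofReal_div_of_pos hq, ENNReal.toReal_ofReal (by positivity),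
    ← ENNReal.ofReal_mul hq.le, klFun_apply, log_div hx.ne' hq.ne']
  congr 1
  field_simp

lemma bregman_eq {x q : ℝ≥0∞} (hx0 : x ≠ 0) (hx : x ≠ ∞) (hq0 : q ≠ 0) (hq : q ≠ ∞) :
    bregman x q = ENNReal.ofReal
      (x.toReal * log x.toReal - x.toReal * log q.toReal + q.toReal - x.toReal) := by
  rw [← bregman_ofReal (ENNReal.toReal_pos hx0 hx) (ENNReal.toReal_pos hq0 hq),
    ENNReal.ofReal_toReal hx, ENNReal.ofReal_toReal hq]

lemma tendsto_bregman {ι : Type*} {l : Filter ι} {u v : ι → ℝ≥0∞} {x q : ℝ≥0∞}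
    (hu : Tendsto u l (𝓝 x)) (hv : Tendsto v l (𝓝 q)) (hx : x ≠ ∞) (hq0 : q ≠ 0) (hq : q ≠ ∞) :
    Tendsto (fun i => bregman (u i) (v i)) l (𝓝 (bregman x q)) := by
  unfold bregman
  refine ENNReal.Tendsto.mul hv (Or.inl hq0) ?_ (Or.inr hq)
  refine ENNReal.tendsto_ofReal ((continuous_klFun.tendsto _).comp ?_)
  exact (ENNReal.tendsto_toReal (ENNReal.div_ne_top hx hq0)).comp
    (ENNReal.Tendsto.div hu (Or.inr hq0) hv (Or.inr hx))

/-- Enlarging the reference density by at most a factor `c⁻¹` costs at most `-log c`. -/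
lemma bregman_add_le {x q q' : ℝ≥0∞} {c : ℝ} (hc : 0 < c) (hx0 : x ≠ 0) (hx : x ≠ ∞)
    (hq0 : q ≠ 0) (hq : q ≠ ∞) (hq' : q' ≠ ∞) (hcq : ENNReal.ofReal c * q ≤ q') (hc1 : c ≤ 1) :
    bregman x q' + q ≤ bregman x q + ENNReal.ofReal (-log c) * x + q' := by
  have hq'0 : q' ≠ 0 := by
    rintro rfl
    simp only [nonpos_iff_eq_zero, mul_eq_zero, ENNReal.ofReal_eq_zero] at hcq
    rcases hcq with h | h
    · linarith
    · exact hq0 h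
  have px := ENNReal.toReal_pos hx0 hx
  have pq := ENNReal.toReal_pos hq0 hq
  have pq' := ENNReal.toReal_pos hq'0 hq'
  have hlogc : 0 ≤ -log c := by have := log_nonpos hc.le hc1; linarith
  have hle : log c + log q.toReal ≤ log q'.toReal := by
    rw [← log_mul hc.ne' pq.ne']
    refine log_le_log (by positivity) ?_
    have := ENNReal.toReal_mono hq' hcq
    rwa [ENNReal.toReal_mul, ENNReal.toReal_ofReal hc.le] at this
  rw [bregman_eq hx0 hx hq0 hq, bregman_eq hx0 hx hq'0 hq']
  have ex : ENNReal.ofReal (-log c) * x = ENNReal.ofReal (-log c) * ENNReal.ofReal x.toReal := by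
    rw [ENNReal.ofReal_toReal hx]
  rw [ex]
  conv_lhs => arg 2; rw [← ENNReal.ofReal_toReal hq]
  conv_rhs => arg 2; rw [← ENNReal.ofReal_toReal hq']
  rw [← ENNReal.ofReal_mul hlogc, ← ENNReal.ofReal_add (bregmanReal_nonneg px pq') pq.le,
    ← ENNReal.ofReal_add (bregmanReal_nonneg px pq) (by positivity), ← ENNReal.ofReal_add
      (add_nonneg (bregmanReal_nonneg px pq) (by positivity)) pq'.le]
  refine ENNReal.ofReal_le_ofReal ?_
  nlinarith [mul_le_mul_of_nonneg_left hle px.le]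

/-- The mean of a density is the optimal reference density. -/
lemma lintegral_bregman_mean_le {Θ : Type*} [MeasurableSpace Θ] {b : Measure Θ}
    [IsProbabilityMeasure b] {L : Θ → ℝ≥0∞} (hL : Measurable L) (hL0 : ∀ θ, L θ ≠ 0)
    (hL1 : ∀ θ, L θ ≠ ∞) (hm : ∫⁻ θ, L θ ∂b ≠ ∞) {q : ℝ≥0∞} (hq0 : q ≠ 0) (hq : q ≠ ∞) :
    ∫⁻ θ, bregman (L θ) (∫⁻ θ, L θ ∂b) ∂b ≤ ∫⁻ θ, bregman (L θ) q ∂b := by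
  set m := ∫⁻ θ, L θ ∂b with hmdef
  have hm0 : m ≠ 0 := by
    rw [hmdef, Ne, lintegral_eq_zero_iff hL]
    intro h
    obtain ⟨θ, hθ⟩ := h.exists
    exact hL0 θ hθ
  by_cases htop : ∫⁻ θ, bregman (L θ) q ∂b = ∞
  · rw [htop]; exact le_top
  have pm := ENNReal.toReal_pos hm0 hm
  have pq := ENNReal.toReal_pos hq0 hq
  have pL : ∀ θ, 0 < (L θ).toReal := fun θ => ENNReal.toReal_pos (hL0 θ) (hL1 θ)
  have e1 : ∀ θ, bregman (L θ) q = ENNReal.ofReal ((L θ).toReal * log (L θ).toReal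
      - (L θ).toReal * log q.toReal + q.toReal - (L θ).toReal) :=
    fun θ => bregman_eq (hL0 θ) (hL1 θ) hq0 hq
  have e2 : ∀ θ, bregman (L θ) m = ENNReal.ofReal ((L θ).toReal * log (L θ).toReal
      - (L θ).toReal * log m.toReal + m.toReal - (L θ).toReal) :=
    fun θ => bregman_eq (hL0 θ) (hL1 θ) hm0 hm
  simp only [e1] at htop
  have hint1 : Integrable (fun θ => (L θ).toReal * log (L θ).toReal
      - (L θ).toReal * log q.toReal + q.toReal - (L θ).toReal) b := by
    refine (lintegral_ofReal_ne_top_iff_integrable ?_ ?_).1 htop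
    · exact Measurable.aestronglyMeasurable (by fun_prop)
    · exact ae_of_all _ fun θ => bregmanReal_nonneg (pL θ) pq
  have hintL : Integrable (fun θ => (L θ).toReal) b :=
    integrable_toReal_of_lintegral_ne_top hL.aemeasurable hm
  have hLint : ∫ θ, (L θ).toReal ∂b = m.toReal :=
    integral_toReal hL.aemeasurable (ae_of_all _ fun θ => (hL1 θ).lt_top)
  -- The two integrands differ by an affine function of `L`, whose mean is minus the divergence
  -- integrand of `m` against `q`, hence nonpositive.
  have heq : (fun θ => (L θ).toReal * log (L θ).toReal - (L θ).toReal * log m.toReal + m.toReal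
        - (L θ).toReal)
      = fun θ => ((L θ).toReal * log (L θ).toReal - (L θ).toReal * log q.toReal + q.toReal
        - (L θ).toReal) + ((log q.toReal - log m.toReal) * (L θ).toReal
        + (m.toReal - q.toReal)) := by
    funext θ; ring
  have hint2' : Integrable (fun θ => (log q.toReal - log m.toReal) * (L θ).toReal
        + (m.toReal - q.toReal)) b := (hintL.const_mul _).add (integrable_const _)
  have hint2 : Integrable (fun θ => (L θ).toReal * log (L θ).toReal - (L θ).toReal * log m.toReal
      + m.toReal - (L θ).toReal) b := by
    rw [heq]; exact hint1.add hint2'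
  simp only [e1, e2]
  rw [← ofReal_integral_eq_lintegral_ofReal hint1
      (ae_of_all _ fun θ => bregmanReal_nonneg (pL θ) pq),
    ← ofReal_integral_eq_lintegral_ofReal hint2
      (ae_of_all _ fun θ => bregmanReal_nonneg (pL θ) pm)]
  refine ENNReal.ofReal_le_ofReal ?_
  rw [heq, integral_add hint1 hint2', integral_add (hintL.const_mul _) (integrable_const _),
    integral_const_mul, hLint]
  simp only [integral_const, probReal_univ, one_smul]
  have := bregmanReal_nonneg pm pq
  linarith

/-- The Kullback-Leibler divergence between two Gaussian densities. -/
lemma lintegral_bregman_gaussianPDF (m₁ m₂ : ℝ) {v₁ v₂ : ℝ≥0} (h₁ : 0 < v₁) (h₂ : 0 < v₂) :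
    ∫⁻ x, bregman (gaussianPDF m₁ v₁ x) (gaussianPDF m₂ v₂ x) = ENNReal.ofReal
      ((log v₂ - log v₁) / 2 - 1 / 2 + (v₁ + (m₁ - m₂) ^ 2) / (2 * v₂)) := by
  have p₁ : (0 : ℝ) < v₁ := h₁
  have p₂ : (0 : ℝ) < v₂ := h₂
  have g₁ : ∀ x, 0 < gaussianPDFReal m₁ v₁ x := fun x => gaussianPDFReal_pos _ _ _ h₁.ne'
  have g₂ : ∀ x, 0 < gaussianPDFReal m₂ v₂ x := fun x => gaussianPDFReal_pos _ _ _ h₂.ne'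
  have hlog : ∀ (m : ℝ) (v : ℝ≥0) (x : ℝ), 0 < (v : ℝ) → log (gaussianPDFReal m v x)
      = -(log (2 * π) + log v) / 2 - (x - m) ^ 2 / (2 * v) := by
    intro m v x hv
    rw [gaussianPDFReal_def, log_mul (by positivity) (exp_pos _).ne', log_exp, log_inv,
      log_sqrt (by positivity), log_mul (by positivity) hv.ne']
    ring
  -- The log-likelihood ratio. The divergence is its mean under the first Gaussian; the remaining
  -- difference of densities integrates to 0.
  set ψ : ℝ → ℝ := fun x => (log v₂ - log v₁) / 2 - (x - m₁) ^ 2 / (2 * v₁)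
    + (x - m₂) ^ 2 / (2 * v₂) with hψ
  have hpt : ∀ x, gaussianPDFReal m₁ v₁ x * log (gaussianPDFReal m₁ v₁ x)
      - gaussianPDFReal m₁ v₁ x * log (gaussianPDFReal m₂ v₂ x) + gaussianPDFReal m₂ v₂ x
      - gaussianPDFReal m₁ v₁ x = gaussianPDFReal m₁ v₁ x • ψ x + (gaussianPDFReal m₂ v₂ x
      - gaussianPDFReal m₁ v₁ x) := by
    intro x
    rw [hlog _ _ _ p₁, hlog _ _ _ p₂, hψ, smul_eq_mul]
    ring
  have hsq : ∀ c : ℝ, Integrable (fun x => (x - c) ^ 2) (gaussianReal m₁ v₁) := by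
    intro c
    exact ((memLp_id_gaussianReal 2).sub (memLp_const c)).integrable_sq
  have hψi : Integrable ψ (gaussianReal m₁ v₁) :=
    ((integrable_const _).sub ((hsq m₁).div_const _)).add ((hsq m₂).div_const _)
  have hψi' : Integrable (fun x => gaussianPDFReal m₁ v₁ x • ψ x) := by
    rw [gaussianReal_of_var_ne_zero _ h₁.ne'] at hψi
    rw [integrable_withDensity_iff_integrable_smul' (measurable_gaussianPDF _ _)
      (ae_of_all _ fun _ => gaussianPDF_lt_top)] at hψi
    simpa only [toReal_gaussianPDF] using hψi
  have hdiff : Integrable (fun x => gaussianPDFReal m₂ v₂ x - gaussianPDFReal m₁ v₁ x) :=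
    (integrable_gaussianPDFReal _ _).sub (integrable_gaussianPDFReal _ _)
  have hvar : ∫ x, (x - m₁) ^ 2 ∂gaussianReal m₁ v₁ = v₁ := by
    have h := variance_fun_id_gaussianReal (μ := m₁) (v := v₁)
    rw [variance_eq_integral (by fun_prop)] at h
    simpa [integral_id_gaussianReal] using h
  have hid : Integrable (fun x => x - m₁) (gaussianReal m₁ v₁) :=
    ((memLp_id_gaussianReal 1).integrable (by simp)).sub (integrable_const _)
  have hmean : ∫ x, (x - m₁) ∂gaussianReal m₁ v₁ = 0 := by
    have h1 : Integrable (fun x : ℝ => x) (gaussianReal m₁ v₁) :=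
      (memLp_id_gaussianReal 1).integrable (by simp)
    rw [integral_sub h1 (integrable_const _)]
    simp [integral_id_gaussianReal]
  have hvar₂ : ∫ x, (x - m₂) ^ 2 ∂gaussianReal m₁ v₁ = v₁ + (m₁ - m₂) ^ 2 := by
    have : (fun x : ℝ => (x - m₂) ^ 2)
        = fun x => ((x - m₁) ^ 2 + 2 * (m₁ - m₂) * (x - m₁)) + (m₁ - m₂) ^ 2 := by
      funext x; ring
    have h1 : Integrable (fun x : ℝ => (x - m₁) ^ 2 + 2 * (m₁ - m₂) * (x - m₁))
      (gaussianReal m₁ v₁) := (hsq m₁).add (hid.const_mul _)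
    rw [this, integral_add h1 (integrable_const _), integral_add (hsq m₁) (hid.const_mul _), integral_const_mul, hvar, hmean]
    simp
  have hψint : ∫ x, ψ x ∂gaussianReal m₁ v₁
      = (log v₂ - log v₁) / 2 - 1 / 2 + (v₁ + (m₁ - m₂) ^ 2) / (2 * v₂) := by
    have h1 : Integrable (fun x : ℝ => (log v₂ - log v₁) / 2 - (x - m₁) ^ 2 / (2 * v₁))
      (gaussianReal m₁ v₁) := (integrable_const _).sub ((hsq m₁).div_const _)
    simp only [hψ]
    rw [integral_add h1 ((hsq m₂).div_const _),
      integral_sub (integrable_const _) ((hsq m₁).div_const _), integral_div, integral_div,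
      integral_div, hvar, hvar₂]
    simp only [integral_const, probReal_univ, one_smul]
    field_simp
  have e : ∀ x, bregman (gaussianPDF m₁ v₁ x) (gaussianPDF m₂ v₂ x) = ENNReal.ofReal
      (gaussianPDFReal m₁ v₁ x • ψ x + (gaussianPDFReal m₂ v₂ x - gaussianPDFReal m₁ v₁ x)) := by
    intro x
    rw [gaussianPDF, gaussianPDF, bregman_ofReal (g₁ x) (g₂ x), hpt]
  simp only [e]
  have hsum : Integrable (fun x => gaussianPDFReal m₁ v₁ x • ψ x
    + (gaussianPDFReal m₂ v₂ x - gaussianPDFReal m₁ v₁ x)) := hψi'.add hdiff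
  rw [← ofReal_integral_eq_lintegral_ofReal hsum (ae_of_all _ fun x => by
      simp only [Pi.zero_apply, ← hpt x]; exact bregmanReal_nonneg (g₁ x) (g₂ x)),
    integral_add hψi' hdiff, ← integral_gaussianReal_eq_integral_smul h₁.ne', hψint,
    integral_sub (integrable_gaussianPDFReal _ _) (integrable_gaussianPDFReal _ _),
    integral_gaussianPDFReal_eq_one _ h₁.ne', integral_gaussianPDFReal_eq_one _ h₂.ne']
  simp

end Bregman

/-! ### Likelihood, evidence and information gain -/

namespace Dynamics

section Likelihood

variable (M : Dynamics A Θ)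

lemma likelihood_ne_zero (x : ℝ × A) (s' : ℝ) (θ : Θ) : M.likelihood x s' θ ≠ 0 :=
  (gaussianPDF_pos _ (M.var_pos θ).ne' _).ne'

lemma likelihood_ne_top (x : ℝ × A) (s' : ℝ) (θ : Θ) : M.likelihood x s' θ ≠ ∞ :=
  gaussianPDF_ne_top

lemma lintegral_likelihood (x : ℝ × A) (θ : Θ) : ∫⁻ s', M.likelihood x s' θ = 1 :=
  lintegral_gaussianPDF_eq_one _ (M.var_pos θ).ne'

/-- `f` is a Carathéodory function, continuous in the state-action pair and measurable in `θ`, hence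
jointly measurable. -/
lemma measurable_uncurry_likelihood :
    Measurable (fun p : (ℝ × A) × ℝ × Θ => M.likelihood p.1 p.2.1 p.2.2) := by
  have hf : Measurable (fun p : (ℝ × A) × Θ => M.f p.2 p.1) :=
    measurable_uncurry_of_continuous_of_measurable (u := fun (x : ℝ × A) θ => M.f θ x)
      (fun θ => (M.f θ).continuous) (fun x => M.measurable_f x)
  have h := measurable_uncurry_gaussianPDF.comp
    (((hf.comp (measurable_fst.prodMk measurable_snd.snd)).prodMk
      ((M.measurable_var.comp measurable_snd.snd).prodMk measurable_snd.fst)) :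
      Measurable (fun p : (ℝ × A) × ℝ × Θ => (M.f p.2.2 p.1, M.var p.2.2, p.2.1)))
  exact h

@[fun_prop]
lemma measurable_likelihood {α : Type*} [MeasurableSpace α] {x : α → ℝ × A} {y : α → ℝ}
    {θ : α → Θ} (hx : Measurable x) (hy : Measurable y) (hθ : Measurable θ) :
    Measurable (fun p => M.likelihood (x p) (y p) (θ p)) :=
  M.measurable_uncurry_likelihood.comp (hx.prodMk (hy.prodMk hθ))

/-- The density `p_b(s' | s, a)` of the posterior predictive transition. -/
def evidence (b : Measure Θ) (x : ℝ × A) (s' : ℝ) : ℝ≥0∞ := ∫⁻ θ, M.likelihood x s' θ ∂b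

lemma measurable_evidence (b : Measure Θ) [SFinite b] (x : ℝ × A) :
    Measurable (M.evidence b x) :=
  Measurable.lintegral_prod_right' (f := fun p : ℝ × Θ => M.likelihood x p.1 p.2) (by fun_prop)

lemma evidence_ne_zero (b : Measure Θ) [IsProbabilityMeasure b] (x : ℝ × A) (s' : ℝ) :
    M.evidence b x s' ≠ 0 := by
  rw [evidence, Ne, lintegral_eq_zero_iff (by fun_prop)]
  intro h
  obtain ⟨θ, hθ⟩ := h.exists
  exact M.likelihood_ne_zero x s' θ hθ

/-- Tonelli, and each likelihood has mass one in `s'`. This is the martingale property of beliefs: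
the posterior mean of `F`, averaged over the next state, is its prior mean. -/
lemma lintegral_evidence_mul (b : Measure Θ) [SFinite b] (x : ℝ × A) {F : Θ → ℝ≥0∞}
    (hF : Measurable F) : ∫⁻ s', ∫⁻ θ, F θ * M.likelihood x s' θ ∂b = ∫⁻ θ, F θ ∂b := by
  rw [lintegral_lintegral_swap (by
    have : Measurable (fun p : ℝ × Θ => F p.2 * M.likelihood x p.1 p.2) := by fun_prop
    exact this.aemeasurable)]
  refine lintegral_congr fun θ => ?_
  rw [lintegral_const_mul _ (by fun_prop), M.lintegral_likelihood, mul_one]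

lemma lintegral_evidence (b : Measure Θ) [IsProbabilityMeasure b] (x : ℝ × A) :
    ∫⁻ s', M.evidence b x s' = 1 := by
  simpa [evidence] using M.lintegral_evidence_mul b x (F := fun _ => 1) measurable_const

lemma evidence_ae_ne_top (b : Measure Θ) [IsProbabilityMeasure b] (x : ℝ × A) :
    ∀ᵐ s', M.evidence b x s' ≠ ∞ := by
  filter_upwards [ae_lt_top (M.measurable_evidence b x) (by simp [M.lintegral_evidence b x])]
    with s' h using h.ne

lemma transition_apply (s : ℝ) (a : A) (θ : Θ) :
    M.transition s a θ = volume.withDensity (fun s' => M.likelihood (s, a) s' θ) :=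
  gaussianReal_of_var_ne_zero _ (M.var_pos θ).ne'

instance (s : ℝ) (a : A) : IsMarkovKernel (M.transition s a) :=
  ⟨fun θ => inferInstanceAs (IsProbabilityMeasure (gaussianReal (M.f θ (s, a)) (M.var θ)))⟩

lemma predictive_eq (b : Measure Θ) [SFinite b] (s : ℝ) (a : A) :
    M.predictive b s a = volume.withDensity (M.evidence b (s, a)) := by
  refine Measure.ext_of_lintegral _ fun F hF => ?_
  rw [predictive, Measure.lintegral_bind (M.transition s a).measurable.aemeasurable
      hF.aemeasurable, lintegral_withDensity_eq_lintegral_mul _ (M.measurable_evidence b _) hF]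
  have : ∀ θ, ∫⁻ s', F s' ∂(M.transition s a θ) = ∫⁻ s', M.likelihood (s, a) s' θ * F s' := by
    intro θ
    rw [transition_apply, lintegral_withDensity_eq_lintegral_mul _ (by fun_prop) hF]
    rfl
  simp only [this]
  rw [lintegral_lintegral_swap (by
    have : Measurable (fun p : Θ × ℝ => M.likelihood (s, a) p.2 p.1 * F p.2) := by fun_prop
    exact this.aemeasurable)]
  refine lintegral_congr fun s' => ?_
  rw [lintegral_mul_const _ (by fun_prop)]
  rfl

instance (b : Measure Θ) [IsProbabilityMeasure b] (s : ℝ) (a : A) :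
    IsProbabilityMeasure (M.predictive b s a) := by
  rw [predictive_eq]
  exact ⟨by simp [M.lintegral_evidence b]⟩

lemma compProd_transition_eq (b : Measure Θ) [SFinite b] (s : ℝ) (a : A) :
    b ⊗ₘ M.transition s a
      = (b.prod volume).withDensity (fun p => M.likelihood (s, a) p.2 p.1) := by
  refine Measure.ext_of_lintegral _ fun F hF => ?_
  rw [Measure.lintegral_compProd hF, lintegral_withDensity_eq_lintegral_mul _ (by fun_prop) hF,
    lintegral_prod _ (by
      have : Measurable ((fun p : Θ × ℝ => M.likelihood (s, a) p.2 p.1) * F) :=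
        Measurable.mul (by fun_prop) hF
      exact this.aemeasurable)]
  refine lintegral_congr fun θ => ?_
  rw [transition_apply, lintegral_withDensity_eq_lintegral_mul _ (by fun_prop) (by fun_prop)]
  rfl

/-- The mutual information as the mean divergence of the transition densities from the predictive
density. -/
lemma infoGain_eq (b : Measure Θ) [IsProbabilityMeasure b] (s : ℝ) (a : A) :
    M.infoGain b s a = ∫⁻ θ, (∫⁻ s', bregman (M.likelihood (s, a) s' θ)
      (M.evidence b (s, a) s')) ∂b := by
  have hE := M.measurable_evidence b (s, a)
  have hL : Measurable (fun p : Θ × ℝ => M.likelihood (s, a) p.2 p.1) := by fun_prop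
  have hE2 : Measurable (fun p : Θ × ℝ => M.evidence b (s, a) p.2) := by fun_prop
  have hR : Measurable (fun p : Θ × ℝ => M.likelihood (s, a) p.2 p.1 / M.evidence b (s, a) p.2) :=
    hL.div hE2
  have hfin : ∀ᵐ p ∂(b.prod (volume : Measure ℝ)), M.evidence b (s, a) p.2 ≠ ∞ :=
    Measure.quasiMeasurePreserving_snd.ae (M.evidence_ae_ne_top b (s, a))
  have hν : b.prod (M.predictive b s a)
      = (b.prod volume).withDensity (fun p => M.evidence b (s, a) p.2) := by
    rw [predictive_eq, prod_withDensity_right hE]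
  have hμ : b ⊗ₘ M.transition s a = (b.prod (M.predictive b s a)).withDensity
      (fun p => M.likelihood (s, a) p.2 p.1 / M.evidence b (s, a) p.2) := by
    rw [compProd_transition_eq, hν, ← withDensity_mul _ hE2 hR]
    refine withDensity_congr_ae ?_
    filter_upwards [hfin] with p hp
    exact (ENNReal.mul_div_cancel (M.evidence_ne_zero b _ _) hp).symm
  have hac : b ⊗ₘ M.transition s a ≪ b.prod (M.predictive b s a) := by
    rw [hμ]; exact withDensity_absolutelyContinuous _ _
  have hrn : (b ⊗ₘ M.transition s a).rnDeriv (b.prod (M.predictive b s a))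
      =ᵐ[b.prod (M.predictive b s a)]
      fun p => M.likelihood (s, a) p.2 p.1 / M.evidence b (s, a) p.2 := by
    have h := Measure.rnDeriv_withDensity (b.prod (M.predictive b s a)) hR
    rwa [← hμ] at h
  have hmeas : Measurable (fun p : Θ × ℝ => ENNReal.ofReal (InformationTheory.klFun
      (M.likelihood (s, a) p.2 p.1 / M.evidence b (s, a) p.2).toReal)) :=
    (InformationTheory.measurable_klFun.comp hR.ennreal_toReal).ennreal_ofReal
  rw [infoGain, InformationTheory.klDiv_eq_lintegral_klFun_of_ac hac,
    lintegral_congr_ae (g := fun p => ENNReal.ofReal (InformationTheory.klFun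
      (M.likelihood (s, a) p.2 p.1 / M.evidence b (s, a) p.2).toReal))
      (by filter_upwards [hrn] with p hp; rw [hp]),
    hν, lintegral_withDensity_eq_lintegral_mul _ hE2 hmeas,
    lintegral_prod _ (hE2.mul hmeas).aemeasurable]
  rfl

end Likelihood

end Dynamics

/-! ### Concentrating beliefs have vanishing information gain -/

/-- Integrated form of `bregman_add_le`: all three densities have mass one, so the added `q` and
`q'` cancel and the weight of `-log c` is 1. -/
lemma lintegral_bregman_le {α : Type*} [MeasurableSpace α] {μ : Measure α} {x q q' : α → ℝ≥0∞}
    (hx : Measurable x) (hq : Measurable q) (hx0 : ∀ y, x y ≠ 0) (hx1 : ∀ᵐ y ∂μ, x y ≠ ∞)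
    (hq0 : ∀ y, q y ≠ 0) (hq1 : ∀ᵐ y ∂μ, q y ≠ ∞) (hq'1 : ∀ᵐ y ∂μ, q' y ≠ ∞)
    (hq' : Measurable q')
    (ix : ∫⁻ y, x y ∂μ = 1) (iq : ∫⁻ y, q y ∂μ = 1) (iq' : ∫⁻ y, q' y ∂μ = 1)
    {c : ℝ} (hc : 0 < c) (hc1 : c ≤ 1) (hle : ∀ y, ENNReal.ofReal c * q y ≤ q' y) :
    ∫⁻ y, bregman (x y) (q' y) ∂μ
      ≤ ∫⁻ y, bregman (x y) (q y) ∂μ + ENNReal.ofReal (-Real.log c) := by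
  have h : ∫⁻ y, bregman (x y) (q' y) + q y ∂μ
      ≤ ∫⁻ y, bregman (x y) (q y) + ENNReal.ofReal (-Real.log c) * x y + q' y ∂μ := by
    refine lintegral_mono_ae ?_
    filter_upwards [hx1, hq1, hq'1] with y h1 h2 h3
    exact bregman_add_le hc (hx0 y) h1 (hq0 y) h2 h3 (hle y) hc1
  rw [lintegral_add_right _ hq, lintegral_add_right _ hq', lintegral_add_right _ (hx.const_mul _),
    lintegral_const_mul _ hx, ix, iq, iq', mul_one] at h
  exact (ENNReal.add_le_add_iff_right ENNReal.one_ne_top).1 h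

namespace Dynamics

section InfoGain

variable (M : Dynamics A Θ)

/-- The predictive density is the mean likelihood, hence the optimal reference for each `s'`
separately (`lintegral_bregman_mean_le`). The mass term inside `bregman` makes normalization of `q`
unnecessary. -/
lemma infoGain_le (b : Measure Θ) [IsProbabilityMeasure b] (s : ℝ) (a : A) {q : ℝ → ℝ≥0∞}
    (hq : Measurable q) (hq0 : ∀ y, q y ≠ 0) (hq1 : ∀ᵐ y, q y ≠ ∞) :
    M.infoGain b s a ≤ ∫⁻ θ, (∫⁻ s', bregman (M.likelihood (s, a) s' θ) (q s')) ∂b := by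
  have hE := M.measurable_evidence b (s, a)
  have m1 : Measurable (fun p : Θ × ℝ => bregman (M.likelihood (s, a) p.2 p.1)
      (M.evidence b (s, a) p.2)) := by fun_prop
  have m2 : Measurable (fun p : Θ × ℝ => bregman (M.likelihood (s, a) p.2 p.1) (q p.2)) := by
    fun_prop
  rw [infoGain_eq, lintegral_lintegral_swap m1.aemeasurable,
    lintegral_lintegral_swap (μ := b) (ν := volume)
      (f := fun θ s' => bregman (M.likelihood (s, a) s' θ) (q s')) m2.aemeasurable]
  refine lintegral_mono_ae ?_
  filter_upwards [M.evidence_ae_ne_top b (s, a), hq1] with s' h h'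
  exact lintegral_bregman_mean_le (by fun_prop) (fun θ => M.likelihood_ne_zero _ _ θ)
    (fun θ => M.likelihood_ne_top _ _ θ) h (hq0 s') h'

/-- The information gain of a belief whose restriction to `S` is a multiple of the belief `b'`. -/
lemma infoGain_le_of_split (b b' : Measure Θ) [IsProbabilityMeasure b] [IsProbabilityMeasure b']
    {S : Set Θ} (hS : MeasurableSet S) (hb' : ∀ F : Θ → ℝ≥0∞, ∫⁻ θ in S, F θ ∂b
      = b S * ∫⁻ θ, F θ ∂b') (s : ℝ) (a : A) {q : ℝ → ℝ≥0∞}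
    (hq : Measurable q) (hq0 : ∀ y, q y ≠ 0) (hq1 : ∀ y, q y ≠ ∞) (iq : ∫⁻ y, q y = 1)
    {c : ℝ} (hc0 : 0 < c) (hc1 : c < 1) :
    M.infoGain b s a ≤ ∫⁻ θ in Sᶜ, (∫⁻ s', bregman (M.likelihood (s, a) s' θ) (q s')) ∂b
      + ENNReal.ofReal (-Real.log (1 - c))
      + b S * (M.infoGain b' s a + ENNReal.ofReal (-Real.log c)) := by
  have hE := M.measurable_evidence b' (s, a)
  -- The mixture dominates both components up to a constant: off `S` it replaces `q` at cost `-log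
  -- (1 - c)`, on `S` it replaces the predictive density of `b'` at cost `-log c`.
  set q' : ℝ → ℝ≥0∞ := fun y => ENNReal.ofReal (1 - c) * q y
    + ENNReal.ofReal c * M.evidence b' (s, a) y with hq'
  have mq' : Measurable q' := by fun_prop
  have hsub : (0 : ℝ) < 1 - c := by linarith
  have hq'0 : ∀ y, q' y ≠ 0 := by
    intro y
    simp only [hq', Ne, add_eq_zero, mul_eq_zero, ENNReal.ofReal_eq_zero, not_and_or, not_or]
    exact Or.inl ⟨by linarith, hq0 y⟩
  have hq'1 : ∀ᵐ y, q' y ≠ ∞ := by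
    filter_upwards [M.evidence_ae_ne_top b' (s, a)] with y hy
    exact ENNReal.add_ne_top.2 ⟨ENNReal.mul_ne_top ENNReal.ofReal_ne_top (hq1 y),
      ENNReal.mul_ne_top ENNReal.ofReal_ne_top hy⟩
  have iq' : ∫⁻ y, q' y = 1 := by
    simp only [hq']
    rw [lintegral_add_left (by fun_prop), lintegral_const_mul _ hq, lintegral_const_mul _ hE, iq,
      lintegral_evidence, mul_one, mul_one, ← ENNReal.ofReal_add hsub.le hc0.le]
    simp
  have hK : ∀ θ, ∫⁻ s', bregman (M.likelihood (s, a) s' θ) (q' s')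
      ≤ (∫⁻ s', bregman (M.likelihood (s, a) s' θ) (q s')) + ENNReal.ofReal (-Real.log (1 - c)) :=
    fun θ => lintegral_bregman_le (x := fun y => M.likelihood (s, a) y θ) (by fun_prop) hq (fun y => M.likelihood_ne_zero _ _ _)
      (ae_of_all _ fun y => M.likelihood_ne_top _ _ _) hq0 (ae_of_all _ hq1) hq'1 mq'
      (M.lintegral_likelihood _ _) iq iq' hsub (by linarith) (fun y => le_self_add)
  have hK' : ∀ θ, ∫⁻ s', bregman (M.likelihood (s, a) s' θ) (q' s')
      ≤ (∫⁻ s', bregman (M.likelihood (s, a) s' θ) (M.evidence b' (s, a) s'))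
        + ENNReal.ofReal (-Real.log c) :=
    fun θ => lintegral_bregman_le (x := fun y => M.likelihood (s, a) y θ) (by fun_prop) hE (fun y => M.likelihood_ne_zero _ _ _)
      (ae_of_all _ fun y => M.likelihood_ne_top _ _ _) (fun y => M.evidence_ne_zero _ _ _)
      (M.evidence_ae_ne_top _ _) hq'1 mq' (M.lintegral_likelihood _ _)
      (M.lintegral_evidence _ _) iq' hc0 hc1.le (fun y => le_add_self)
  calc M.infoGain b s a
      ≤ ∫⁻ θ, (∫⁻ s', bregman (M.likelihood (s, a) s' θ) (q' s')) ∂b :=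
        M.infoGain_le b s a mq' hq'0 hq'1
    _ = ∫⁻ θ in Sᶜ, (∫⁻ s', bregman (M.likelihood (s, a) s' θ) (q' s')) ∂b
        + ∫⁻ θ in S, (∫⁻ s', bregman (M.likelihood (s, a) s' θ) (q' s')) ∂b := by
        rw [add_comm, lintegral_add_compl _ hS]
    _ ≤ _ := ?_
  refine add_le_add ?_ ?_
  · calc _ ≤ ∫⁻ θ in Sᶜ, ((∫⁻ s', bregman (M.likelihood (s, a) s' θ) (q s'))
          + ENNReal.ofReal (-Real.log (1 - c))) ∂b := lintegral_mono hK
      _ = ∫⁻ θ in Sᶜ, (∫⁻ s', bregman (M.likelihood (s, a) s' θ) (q s')) ∂b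
          + ENNReal.ofReal (-Real.log (1 - c)) * b Sᶜ := by
          rw [lintegral_add_right _ measurable_const]; simp
      _ ≤ _ := by
          gcongr
          exact mul_le_of_le_one_right' prob_le_one
  · rw [hb']
    gcongr
    rw [infoGain_eq]
    calc _ ≤ ∫⁻ θ, ((∫⁻ s', bregman (M.likelihood (s, a) s' θ) (M.evidence b' (s, a) s'))
          + ENNReal.ofReal (-Real.log c)) ∂b' := lintegral_mono hK'
      _ = _ := by rw [lintegral_add_right _ measurable_const]; simp

end InfoGain

/-- The normalized restriction of a belief to a set. -/
lemma exists_conditioned_belief (b : Measure Θ) [IsProbabilityMeasure b] (S : Set Θ) :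
    ∃ b' : Measure Θ, IsProbabilityMeasure b' ∧ b' ≪ b ∧
      ∀ F : Θ → ℝ≥0∞, ∫⁻ θ in S, F θ ∂b = b S * ∫⁻ θ, F θ ∂b' := by
  by_cases h : b S = 0
  · refine ⟨b, inferInstance, Measure.AbsolutelyContinuous.rfl, fun F => ?_⟩
    rw [h, zero_mul, Measure.restrict_eq_zero.2 h, lintegral_zero_measure]
  · refine ⟨(b S)⁻¹ • b.restrict S, ⟨?_⟩, ?_, fun F => ?_⟩
    · simp [ENNReal.inv_mul_cancel h (measure_ne_top _ _)]
    · exact Measure.AbsolutelyContinuous.smul_left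
        (Measure.absolutelyContinuous_of_le Measure.restrict_le_self) _
    · rw [lintegral_smul_measure, smul_eq_mul, ← mul_assoc,
        ENNReal.mul_inv_cancel h (measure_ne_top _ _), one_mul]

section Concentration

variable {Θ : Type*} [MetricSpace Θ] [MeasurableSpace Θ] (M : Dynamics A Θ) {θ₀ : Θ}

/-- Evaluation is jointly continuous for the compact-open topology because `ℝ × A` is locally
compact. -/
lemma tendsto_f (hA : IsCompact A) (hf : ContinuousAt M.f θ₀) (s : ℝ) {as : ℕ → A} {a : A}
    (ha : Tendsto as atTop (𝓝 a)) :
    Tendsto (fun p : ℕ × Θ => M.f p.2 (s, as p.1)) (atTop ×ˢ 𝓝 θ₀) (𝓝 (M.f θ₀ (s, a))) := by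
  have : CompactSpace A := isCompact_iff_compactSpace.1 hA
  have h1 : Tendsto (fun p : ℕ × Θ => M.f p.2) (atTop ×ˢ 𝓝 θ₀) (𝓝 (M.f θ₀)) :=
    hf.tendsto.comp tendsto_snd
  have h2 : Tendsto (fun p : ℕ × Θ => ((s, as p.1) : ℝ × A)) (atTop ×ˢ 𝓝 θ₀) (𝓝 (s, a)) :=
    tendsto_const_nhds.prodMk_nhds (ha.comp tendsto_fst)
  exact (continuous_eval.tendsto (M.f θ₀, ((s, a) : ℝ × A))).comp (h1.prodMk_nhds h2)

lemma tendsto_lintegral_bregman (hA : IsCompact A) (hf : ContinuousAt M.f θ₀)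
    (hvar : ContinuousAt M.var θ₀) (s : ℝ) {as : ℕ → A} {a : A} (ha : Tendsto as atTop (𝓝 a)) :
    Tendsto (fun p : ℕ × Θ => ∫⁻ s', bregman (M.likelihood (s, as p.1) s' p.2)
      (M.likelihood (s, a) s' θ₀)) (atTop ×ˢ 𝓝 θ₀) (𝓝 0) := by
  have h1 := M.tendsto_f hA hf s ha
  have h2 : Tendsto (fun p : ℕ × Θ => (M.var p.2 : ℝ)) (atTop ×ˢ 𝓝 θ₀) (𝓝 (M.var θ₀)) :=
    (NNReal.continuous_coe.tendsto _).comp (hvar.tendsto.comp tendsto_snd)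
  have hv : (0 : ℝ) < M.var θ₀ := M.var_pos θ₀
  simp only [likelihood, lintegral_bregman_gaussianPDF _ _ (M.var_pos _) (M.var_pos θ₀)]
  have h3 := ((((h2.log hv.ne').const_sub (Real.log (M.var θ₀))).div_const 2).sub_const
    (1 / 2)).add ((h2.add ((h1.sub_const (M.f θ₀ (s, a))).pow 2)).div_const (2 * (M.var θ₀ : ℝ)))
  have h4 := ENNReal.tendsto_ofReal h3
  convert h4 using 2
  symm
  rw [ENNReal.ofReal_eq_zero]
  field_simp
  simp

variable [BorelSpace Θ]

/-- Far parameters can have arbitrarily large divergence from the true transition, so small far mass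
alone is not enough. The bound `hIG`, applied to the belief conditioned on the far set, supplies the
missing control. -/
lemma tendsto_infoGain (hA : IsCompact A) (hf : ContinuousAt M.f θ₀)
    (hvar : ContinuousAt M.var θ₀) {prior : Measure Θ} {C : ℝ≥0∞} (hC : C ≠ ∞)
    (hIG : ∀ b : Measure Θ, IsProbabilityMeasure b → b ≪ prior → ∀ s a, M.infoGain b s a ≤ C)
    {b : ℕ → Measure Θ} [∀ n, IsProbabilityMeasure (b n)] (hac : ∀ n, b n ≪ prior)
    (hb : Tendsto (fun n => ∫⁻ θ, min 1 (edist θ θ₀) ∂(b n)) atTop (𝓝 0))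
    (s : ℝ) {as : ℕ → A} {a : A} (ha : Tendsto as atTop (𝓝 a)) :
    Tendsto (fun n => M.infoGain (b n) s (as n)) atTop (𝓝 0) := by
  rw [ENNReal.tendsto_nhds_zero]
  intro ε hε
  have hε3 : 0 < ε / 3 := ENNReal.div_pos hε.ne' (by simp)
  -- The weight `c` is fixed before `n`: then `C - log c` is a constant, and the vanishing far mass
  -- absorbs it.
  obtain ⟨c, hc0, hc1, hcε⟩ : ∃ c : ℝ, 0 < c ∧ c < 1 ∧
      ENNReal.ofReal (-Real.log (1 - c)) ≤ ε / 3 := by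
    have hlim : Tendsto (fun c : ℝ => ENNReal.ofReal (-Real.log (1 - c))) (𝓝[>] 0) (𝓝 0) := by
      have : ContinuousAt (fun c : ℝ => ENNReal.ofReal (-Real.log (1 - c))) 0 :=
        ENNReal.continuous_ofReal.continuousAt.comp
          ((continuousAt_const.sub continuousAt_id).log (by simp)).neg
      simpa using this.tendsto.mono_left nhdsWithin_le_nhds
    have h1 : ∀ᶠ c : ℝ in 𝓝[>] 0, c < 1 :=
      (eventually_lt_nhds zero_lt_one).filter_mono nhdsWithin_le_nhds
    obtain ⟨c, h, h', h''⟩ := ((ENNReal.tendsto_nhds_zero.1 hlim _ hε3).and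
      (h1.and self_mem_nhdsWithin)).exists
    exact ⟨c, h'', h', h⟩
  obtain ⟨pa, hpa, pb, hpb, hab⟩ := eventually_prod_iff.1 (ENNReal.tendsto_nhds_zero.1
    (M.tendsto_lintegral_bregman hA hf hvar s ha) _ hε3)
  obtain ⟨δ, hδ, hball⟩ := EMetric.mem_nhds_iff.1 hpb
  set S : Set Θ := {θ | δ ≤ edist θ θ₀} with hSdef
  have hS : MeasurableSet S := measurableSet_le measurable_const (by fun_prop)
  set D : ℝ≥0∞ := C + ENNReal.ofReal (-Real.log c)
  have hD : D ≠ ∞ := ENNReal.add_ne_top.2 ⟨hC, ENNReal.ofReal_ne_top⟩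
  have hSlim : Tendsto (fun n => b n S * D) atTop (𝓝 0) := by
    have h := tendsto_lintegral_of_concentrate hb (T := fun _ => S.indicator fun _ => D) hD
      (fun _ θ => Set.indicator_le_self' (fun _ _ => zero_le) θ) ?_
    · simpa [lintegral_indicator hS, mul_comm] using h
    · refine tendsto_const_nhds.congr' ?_
      have : ∀ᶠ θ in 𝓝 θ₀, θ ∉ S := by
        filter_upwards [Metric.eball_mem_nhds θ₀ hδ] with θ hθ
        exact fun h => not_le_of_gt (Metric.mem_eball.1 hθ) h
      filter_upwards [(tendsto_snd (f := atTop) (g := 𝓝 θ₀)).eventually this] with p hp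
      simp [hp]
  filter_upwards [hpa, ENNReal.tendsto_nhds_zero.1 hSlim _ hε3] with n hn hn'
  obtain ⟨b', hb'p, hb'ac, hb'⟩ := exists_conditioned_belief (b n) S
  calc M.infoGain (b n) s (as n)
      ≤ _ := M.infoGain_le_of_split (b n) b' hS hb' s (as n)
        (q := fun y => M.likelihood (s, a) y θ₀) (by fun_prop)
        (fun y => M.likelihood_ne_zero _ _ _) (fun y => M.likelihood_ne_top _ _ _)
        (M.lintegral_likelihood _ _) hc0 hc1
    _ ≤ ε / 3 + ε / 3 + ε / 3 := by
        refine add_le_add (add_le_add ?_ hcε) ?_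
        · calc _ ≤ ∫⁻ _ in Sᶜ, ε / 3 ∂(b n) := by
                refine setLIntegral_mono measurable_const fun θ hθ => ?_
                exact hab hn (hball (Metric.mem_eball.2 (not_le.1 fun h => hθ h)))
            _ ≤ ε / 3 := by
                rw [setLIntegral_const]
                exact mul_le_of_le_one_right' prob_le_one
        · refine le_trans ?_ hn'
          gcongr
          exact add_le_add_left (hIG b' hb'p (hb'ac.trans (hac n)) _ _) _
    _ = ε := ENNReal.add_thirds ε

end Concentration

end Dynamics

/-! ### Asymptotic lower bounds -/

section LiminfGE

/-- `x` is at most the lower limit of the real sequence `u`. -/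
def LiminfGE (u : ℕ → ℝ) (x : ℝ) : Prop := ∀ c < x, ∀ᶠ n in atTop, c < u n

lemma LiminfGE.of_tendsto {u : ℕ → ℝ} {x : ℝ} (h : Tendsto u atTop (𝓝 x)) : LiminfGE u x :=
  fun _ hc => h.eventually_const_lt hc

lemma LiminfGE.add {u v : ℕ → ℝ} {x y : ℝ} (hu : LiminfGE u x) (hv : LiminfGE v y) :
    LiminfGE (fun n => u n + v n) (x + y) := by
  intro c hc
  filter_upwards [hu (x - (x + y - c) / 2) (by linarith), hv (y - (x + y - c) / 2) (by linarith)]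
    with n h1 h2
  linarith

lemma LiminfGE.mul {u m : ℕ → ℝ} {x m' : ℝ} (hu : LiminfGE u x) (hu0 : ∀ n, 0 ≤ u n)
    (hm : Tendsto m atTop (𝓝 m')) (hm0 : ∀ n, 0 ≤ m n) (hm' : 0 < m') :
    LiminfGE (fun n => m n * u n) (m' * x) := by
  intro c hc
  rcases lt_or_ge c 0 with h | h
  · exact Eventually.of_forall fun n => h.trans_le (mul_nonneg (hm0 n) (hu0 n))
  · obtain ⟨d, hd, hdx⟩ := exists_between ((div_lt_iff₀' hm').2 hc)
    have hcd : c < m' * d := (div_lt_iff₀' hm').1 hd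
    filter_upwards [hu d hdx, (hm.mul_const d).eventually_const_lt hcd] with n h1 h2
    exact h2.trans_le (mul_le_mul_of_nonneg_left h1.le (hm0 n))

lemma LiminfGE.const_mul {u : ℕ → ℝ} {x c : ℝ} (hu : LiminfGE u x) (hc : 0 ≤ c) :
    LiminfGE (fun n => c * u n) (c * x) := by
  rcases hc.eq_or_lt with rfl | hc
  · simpa using LiminfGE.of_tendsto (tendsto_const_nhds (x := (0 : ℝ)))
  · intro d hd
    filter_upwards [hu _ ((div_lt_iff₀' hc).2 hd)] with n h
    exact (div_lt_iff₀' hc).1 h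

/-- Lets lower bounds be proved along almost everywhere convergent subsequences, which is all that
`L¹` convergence provides. -/
lemma LiminfGE.of_subseq {u : ℕ → ℝ} {x : ℝ} (h : ∀ φ : ℕ → ℕ, StrictMono φ →
    ∃ ψ : ℕ → ℕ, StrictMono ψ ∧ LiminfGE (fun n => u (φ (ψ n))) x) : LiminfGE u x := by
  intro c hc
  by_contra hcon
  obtain ⟨φ, hφ, hle⟩ := extraction_of_frequently_atTop (not_eventually.1 hcon)
  obtain ⟨ψ, -, hψ⟩ := h φ hφ
  obtain ⟨n, hn⟩ := (hψ c hc).exists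
  exact hle _ hn

lemma LiminfGE.toReal {u : ℕ → ℝ≥0∞} {x : ℝ≥0∞} (hu : ∀ n, u n ≠ ∞)
    (h : x ≤ liminf u atTop) : LiminfGE (fun n => (u n).toReal) x.toReal := by
  intro c hc
  rcases lt_or_ge c 0 with h0 | h0
  · exact Eventually.of_forall fun n => h0.trans_le ENNReal.toReal_nonneg
  · have hx : x ≠ ∞ := by
      rintro rfl
      simp only [ENNReal.toReal_top] at hc
      linarith
    filter_upwards [eventually_lt_of_lt_liminf
      (((ENNReal.ofReal_lt_iff_lt_toReal h0 hx).2 hc).trans_le h)] with n hn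
    exact (ENNReal.ofReal_lt_iff_lt_toReal h0 (hu n)).1 hn

lemma LiminfGE.ofReal {u : ℕ → ℝ} {x : ℝ} (h : LiminfGE u x) :
    ENNReal.ofReal x ≤ liminf (fun n => ENNReal.ofReal (u n)) atTop := by
  refine le_of_forall_lt fun c hc => ?_
  obtain ⟨d, hcd, hdx⟩ := exists_between hc
  refine hcd.trans_le (le_liminf_of_le (by isBoundedDefault) ?_)
  have hd : d ≠ ∞ := hdx.ne_top
  filter_upwards [h d.toReal ((ENNReal.lt_ofReal_iff_toReal_lt hd).1 hdx)] with n hn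
  exact ((ENNReal.lt_ofReal_iff_toReal_lt hd).2 hn).le

variable {α : Type*} [MeasurableSpace α] {μ : Measure α}

/-- Shifting `W` by its bound makes the integrand nonnegative, so that Fatou applies; as `m` has
mass one, the shift costs exactly `B`. -/
lemma integral_toReal_mul_eq {m : α → ℝ≥0∞} {W : α → ℝ} {B : ℝ} (hm : Measurable m)
    (hm1 : ∫⁻ x, m x ∂μ = 1) (hW : AEMeasurable W μ) (hB : ∀ x, |W x| ≤ B) :
    ∫⁻ x, ENNReal.ofReal ((m x).toReal * (W x + B)) ∂μ ≠ ∞ ∧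
    ∫ x, (m x).toReal * W x ∂μ
      = (∫⁻ x, ENNReal.ofReal ((m x).toReal * (W x + B)) ∂μ).toReal + -B := by
  have hi : Integrable (fun x => (m x).toReal) μ :=
    integrable_toReal_of_lintegral_ne_top hm.aemeasurable (by simp [hm1])
  have hiW : Integrable (fun x => (m x).toReal * W x) μ :=
    hi.mul_bdd hW.aestronglyMeasurable (ae_of_all _ hB)
  have hsum : Integrable (fun x => (m x).toReal * (W x + B)) μ := by
    simp only [mul_add]
    exact hiW.add (hi.mul_const B)
  have hnn : 0 ≤ᵐ[μ] fun x => (m x).toReal * (W x + B) := ae_of_all _ fun x =>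
    mul_nonneg ENNReal.toReal_nonneg (by linarith [neg_le_of_abs_le (hB x)])
  have h1 : ∫ x, (m x).toReal ∂μ = 1 := by
    rw [integral_toReal hm.aemeasurable (ae_lt_top hm (by simp [hm1])), hm1, ENNReal.toReal_one]
  refine ⟨(lintegral_ofReal_ne_top_iff_integrable hsum.aestronglyMeasurable hnn).2 hsum, ?_⟩
  rw [← integral_eq_lintegral_of_nonneg_ae hnn hsum.aestronglyMeasurable]
  simp only [mul_add]
  rw [integral_add hiW (hi.mul_const B), integral_mul_const, h1]
  ring

/-- Fatou's lemma for bounded functions weighted by convergent densities. -/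
lemma LiminfGE.integral {m : ℕ → α → ℝ≥0∞} {m' : α → ℝ≥0∞} {W : ℕ → α → ℝ} {W' : α → ℝ} {B : ℝ}
    (hm : ∀ n, Measurable (m n)) (hm' : Measurable m') (hm1 : ∀ n, ∫⁻ x, m n x ∂μ = 1)
    (hm1' : ∫⁻ x, m' x ∂μ = 1) (hm0 : ∀ x, m' x ≠ 0)
    (hW : ∀ n, Measurable (W n)) (hW' : AEMeasurable W' μ) (hB : ∀ n x, |W n x| ≤ B)
    (hB' : ∀ x, |W' x| ≤ B) (hmlim : ∀ᵐ x ∂μ, Tendsto (fun n => m n x) atTop (𝓝 (m' x)))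
    (hWlim : ∀ᵐ x ∂μ, LiminfGE (fun n => W n x) (W' x)) :
    LiminfGE (fun n => ∫ x, (m n x).toReal * W n x ∂μ) (∫ x, (m' x).toReal * W' x ∂μ) := by
  simp only [fun n => (integral_toReal_mul_eq (hm n) (hm1 n) (hW n).aemeasurable (hB n)).2,
    (integral_toReal_mul_eq hm' hm1' hW' hB').2]
  refine LiminfGE.add (LiminfGE.toReal
    (fun n => (integral_toReal_mul_eq (hm n) (hm1 n) (hW n).aemeasurable (hB n)).1) ?_)
    (LiminfGE.of_tendsto tendsto_const_nhds)
  refine le_trans (lintegral_mono_ae ?_) (lintegral_liminf_le fun n => by fun_prop)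
  filter_upwards [hmlim, hWlim, ae_lt_top hm' (by simp [hm1'])] with x h1 h2 h3
  refine LiminfGE.ofReal (LiminfGE.mul (h2.add (LiminfGE.of_tendsto tendsto_const_nhds))
    (fun n => by linarith [neg_le_of_abs_le (hB n x)])
    ((ENNReal.tendsto_toReal h3.ne).comp h1) (fun n => ENNReal.toReal_nonneg)
    (ENNReal.toReal_pos (hm0 x) h3.ne))

end LiminfGE

/-! ### Normalized densities -/

section Normalize

/-- `g` is the density of a probability measure with respect to `μ`. -/
structure IsDensity (μ : Measure Θ) (g : Θ → ℝ≥0∞) : Prop where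
  measurable : Measurable g
  lintegral_eq_one : ∫⁻ θ, g θ ∂μ = 1

lemma IsDensity.isProbabilityMeasure {μ : Measure Θ} {g : Θ → ℝ≥0∞} (hg : IsDensity μ g) :
    IsProbabilityMeasure (μ.withDensity g) :=
  ⟨by rw [withDensity_apply _ MeasurableSet.univ, Measure.restrict_univ, hg.lintegral_eq_one]⟩

open Classical in
/-- The probability density proportional to `h`, and the constant `1` if there is none. -/
def normalize (μ : Measure Θ) (h : Θ → ℝ≥0∞) (θ : Θ) : ℝ≥0∞ :=
  if ∫⁻ θ, h θ ∂μ = 0 ∨ ∫⁻ θ, h θ ∂μ = ∞ then 1 else (∫⁻ θ, h θ ∂μ)⁻¹ * h θ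

lemma normalize_of_ne {μ : Measure Θ} {h : Θ → ℝ≥0∞} (h0 : ∫⁻ θ, h θ ∂μ ≠ 0)
    (h1 : ∫⁻ θ, h θ ∂μ ≠ ∞) : normalize μ h = fun θ => (∫⁻ θ, h θ ∂μ)⁻¹ * h θ := by
  funext θ
  simp [normalize, h0, h1]

variable {μ : Measure Θ}

/-- The default value 1 is itself a density, so updated beliefs are densities for every next state,
with no exceptional set. -/
lemma isDensity_normalize [IsProbabilityMeasure μ] {h : Θ → ℝ≥0∞} (hh : Measurable h) :
    IsDensity μ (normalize μ h) := by
  by_cases hc : ∫⁻ θ, h θ ∂μ = 0 ∨ ∫⁻ θ, h θ ∂μ = ∞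
  · have : normalize μ h = fun _ => 1 := by funext θ; simp only [normalize, if_pos hc]
    rw [this]
    exact ⟨measurable_const, by simp⟩
  · rw [not_or] at hc
    rw [normalize_of_ne hc.1 hc.2]
    exact ⟨hh.const_mul _, by rw [lintegral_const_mul _ hh, ENNReal.inv_mul_cancel hc.1 hc.2]⟩

lemma measurable_normalize [SFinite μ] {𝒴 : Type*} [MeasurableSpace 𝒴] {h : 𝒴 → Θ → ℝ≥0∞}
    (hh : Measurable (Function.uncurry h)) :
    Measurable (Function.uncurry fun y => normalize μ (h y)) := by
  have hint : Measurable (fun p : 𝒴 × Θ => ∫⁻ θ, h p.1 θ ∂μ) :=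
    hh.lintegral_prod_right'.comp measurable_fst
  refine Measurable.ite ?_ measurable_const (hint.inv.mul hh)
  exact (hint (measurableSet_singleton 0)).union (hint (measurableSet_singleton ∞))

lemma tendsto_normalize {h : ℕ → Θ → ℝ≥0∞} {h' : Θ → ℝ≥0∞} (h0 : ∫⁻ θ, h' θ ∂μ ≠ 0)
    (h1 : ∫⁻ θ, h' θ ∂μ ≠ ∞)
    (hint : Tendsto (fun n => ∫⁻ θ, h n θ ∂μ) atTop (𝓝 (∫⁻ θ, h' θ ∂μ))) {θ : Θ}
    (hθ : Tendsto (fun n => h n θ) atTop (𝓝 (h' θ))) :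
    Tendsto (fun n => normalize μ (h n) θ) atTop (𝓝 (normalize μ h' θ)) := by
  rw [normalize_of_ne h0 h1]
  have hlim : Tendsto (fun n => (∫⁻ θ, h n θ ∂μ)⁻¹ * h n θ) atTop
      (𝓝 ((∫⁻ θ, h' θ ∂μ)⁻¹ * h' θ)) :=
    ENNReal.Tendsto.mul (tendsto_inv_iff.2 hint) (Or.inl (ENNReal.inv_ne_zero.2 h1)) hθ
      (Or.inr (ENNReal.inv_ne_top.2 h0))
  refine hlim.congr' ?_
  filter_upwards [hint.eventually_ne h0, hint.eventually_ne h1] with n hn0 hn1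
  rw [normalize_of_ne hn0 hn1]

lemma bayes_withDensity {g L : Θ → ℝ≥0∞} (hg : Measurable g) (hL : Measurable L)
    (h0 : ∫⁻ θ, g θ * L θ ∂μ ≠ 0) (h1 : ∫⁻ θ, g θ * L θ ∂μ ≠ ∞) :
    bayes (μ.withDensity g) L = μ.withDensity (normalize μ fun θ => g θ * L θ) := by
  have e : ∫⁻ θ, L θ ∂(μ.withDensity g) = ∫⁻ θ, g θ * L θ ∂μ :=
    lintegral_withDensity_eq_lintegral_mul _ hg hL
  rw [bayes, e, normalize_of_ne h0 h1, ← withDensity_mul _ hg hL]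
  exact (withDensity_smul _ (hg.mul hL)).symm

end Normalize

/-! ### The Bellman equation in terms of densities -/

lemma tendsto_gaussianPDF {ι : Type*} {l : Filter ι} {m : ι → ℝ} {v : ι → ℝ≥0} {m' : ℝ} {v' : ℝ≥0}
    (hm : Tendsto m l (𝓝 m')) (hv : Tendsto v l (𝓝 v')) (h : 0 < v') (x : ℝ) :
    Tendsto (fun i => gaussianPDF (m i) (v i) x) l (𝓝 (gaussianPDF m' v' x)) := by
  have hv1 : Tendsto (fun i => (v i : ℝ)) l (𝓝 v') := (NNReal.continuous_coe.tendsto _).comp hv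
  have hp : (0 : ℝ) < v' := h
  refine ENNReal.tendsto_ofReal ?_
  simp only [gaussianPDFReal]
  refine Tendsto.mul (Tendsto.inv₀ (hv1.const_mul _).sqrt (by positivity)) ?_
  exact (Real.continuous_exp.tendsto _).comp
    ((((hm.const_sub x).pow 2).neg).div (hv1.const_mul 2) (by positivity))

namespace Dynamics

/-- Standing assumptions: the extrinsic reward is measurable, continuous in the action and bounded
by `R`, and the intrinsic reward is bounded by `C` for all beliefs that are absolutely continuous
with respect to `μ`. -/
structure BoundedReward (M : Dynamics A Θ) (μ : Measure Θ) (r : ℝ → A → ℝ) (η γ R : ℝ)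
    (C : ℝ≥0) : Prop where
  measurable : Measurable (fun p : ℝ × A => r p.1 p.2)
  continuous : ∀ s, Continuous (r s)
  eta_nonneg : 0 ≤ η
  gamma_nonneg : 0 ≤ γ
  abs_le : ∀ s a, |r s a| ≤ R
  infoGain_le : ∀ b : Measure Θ, IsProbabilityMeasure b → b ≪ μ → ∀ s a,
    ENNReal.ofReal η * M.infoGain b s a ≤ C

/-- The bound on the values with `t` steps to go. -/
def valueBound (R C γ : ℝ) : ℕ → ℝ
  | 0 => 0
  | t + 1 => R + C + γ * valueBound R C γ t

/-- The value of an action in the augmented problem. -/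
def Qaugm (M : Dynamics A Θ) (r : ℝ → A → ℝ) (η γ : ℝ) (t : ℕ) (s : ℝ) (b : Measure Θ) (a : A) :
    ℝ :=
  r s a + η * (M.infoGain b s a).toReal +
    γ * ∫ s', M.Vaugm r η γ t s' (bayes b (M.likelihood (s, a) s')) ∂(M.predictive b s a)

/-- The density of the belief updated by the transition `(x, s')`. -/
def update (M : Dynamics A Θ) (μ : Measure Θ) (g : Θ → ℝ≥0∞) (x : ℝ × A) (s' : ℝ) : Θ → ℝ≥0∞ :=
  normalize μ fun θ => g θ * M.likelihood x s' θ

variable {M : Dynamics A Θ} {μ : Measure Θ} {r : ℝ → A → ℝ} {η γ R : ℝ} {C : ℝ≥0}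

section Densities

lemma evidence_withDensity {g : Θ → ℝ≥0∞} (hg : Measurable g) (x : ℝ × A) (s' : ℝ) :
    M.evidence (μ.withDensity g) x s' = ∫⁻ θ, g θ * M.likelihood x s' θ ∂μ :=
  lintegral_withDensity_eq_lintegral_mul _ hg (by fun_prop)

/-- The exception is infinite evidence, where `bayes` returns the zero measure; it is Lebesgue-null
since the evidence has integral one. -/
lemma bayes_eq_update {g : Θ → ℝ≥0∞} (hg : IsDensity μ g) (x : ℝ × A) :
    ∀ᵐ s', bayes (μ.withDensity g) (M.likelihood x s') = μ.withDensity (M.update μ g x s') := by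
  have := hg.isProbabilityMeasure
  filter_upwards [M.evidence_ae_ne_top (μ.withDensity g) x] with s' hs'
  have h0 := M.evidence_ne_zero (μ.withDensity g) x s'
  rw [evidence_withDensity hg.measurable] at hs' h0
  exact bayes_withDensity hg.measurable (by fun_prop) h0 hs'

variable [IsProbabilityMeasure μ] {g : Θ → ℝ≥0∞}

lemma isDensity_update (hg : Measurable g) (x : ℝ × A) (s' : ℝ) :
    IsDensity μ (M.update μ g x s') :=
  isDensity_normalize (by fun_prop)

/-- Moves the dependence on the belief from the measure to a weight against Lebesgue measure, the
form that the limit theorems require. -/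
lemma integral_predictive_eq (hg : IsDensity μ g) (s : ℝ) (a : A) (V : ℝ → Measure Θ → ℝ) :
    ∫ s', V s' (bayes (μ.withDensity g) (M.likelihood (s, a) s'))
        ∂(M.predictive (μ.withDensity g) s a)
      = ∫ s', (M.evidence (μ.withDensity g) (s, a) s').toReal
        * V s' (μ.withDensity (M.update μ g (s, a) s')) := by
  have := hg.isProbabilityMeasure
  rw [predictive_eq, integral_withDensity_eq_integral_toReal_smul (M.measurable_evidence _ _)
    ((M.evidence_ae_ne_top _ _).mono fun _ h => h.lt_top)]
  refine integral_congr_ae ?_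
  filter_upwards [bayes_eq_update (M := M) hg (s, a)] with s' hs'
  rw [hs', smul_eq_mul]

lemma measurable_update_uncurry {𝒴 : Type*} [MeasurableSpace 𝒴] {g : 𝒴 → Θ → ℝ≥0∞}
    (hg : Measurable (Function.uncurry g)) {S : 𝒴 → ℝ} (hS : Measurable S) (a : A) :
    Measurable (Function.uncurry fun p : 𝒴 × ℝ => M.update μ (g p.1) (S p.1, a) p.2) := by
  refine measurable_normalize ?_
  have h1 : Measurable (fun p : (𝒴 × ℝ) × Θ => g p.1.1 p.2) :=
    hg.comp (measurable_fst.fst.prodMk measurable_snd)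
  have h2 : Measurable (fun p : (𝒴 × ℝ) × Θ => M.likelihood (S p.1.1, a) p.1.2 p.2) := by fun_prop
  exact h1.mul h2

lemma measurable_update (hg : Measurable g) (x : ℝ × A) :
    Measurable (Function.uncurry fun s' => M.update μ g x s') := by
  refine measurable_normalize ?_
  exact (hg.comp measurable_snd).mul (by fun_prop :
    Measurable fun p : ℝ × Θ => M.likelihood x p.1 p.2)

lemma measurable_evidence_uncurry {𝒴 : Type*} [MeasurableSpace 𝒴] {g : 𝒴 → Θ → ℝ≥0∞}
    (hg : Measurable (Function.uncurry g)) {S : 𝒴 → ℝ} (hS : Measurable S) (a : A) :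
    Measurable (fun p : 𝒴 × ℝ => M.evidence (μ.withDensity (g p.1)) (S p.1, a) p.2) := by
  have e : ∀ p : 𝒴 × ℝ, M.evidence (μ.withDensity (g p.1)) (S p.1, a) p.2
      = ∫⁻ θ, g p.1 θ * M.likelihood (S p.1, a) p.2 θ ∂μ :=
    fun p => evidence_withDensity (hg.comp measurable_prodMk_left) _ _
  simp only [e]
  have h1 : Measurable (fun p : (𝒴 × ℝ) × Θ => g p.1.1 p.2) :=
    hg.comp (measurable_fst.fst.prodMk measurable_snd)
  have h2 : Measurable (fun p : (𝒴 × ℝ) × Θ => M.likelihood (S p.1.1, a) p.1.2 p.2) := by fun_prop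
  exact (h1.mul h2).lintegral_prod_right'

lemma infoGain_withDensity (hg : IsDensity μ g) (s : ℝ) (a : A) :
    M.infoGain (μ.withDensity g) s a = ∫⁻ p, g p.1 * bregman (M.likelihood (s, a) p.2 p.1)
      (M.evidence (μ.withDensity g) (s, a) p.2) ∂(μ.prod volume) := by
  have := hg.isProbabilityMeasure
  have hE := M.measurable_evidence (μ.withDensity g) (s, a)
  have hgm := hg.measurable
  have h1 : Measurable (fun p : Θ × ℝ => bregman (M.likelihood (s, a) p.2 p.1)
      (M.evidence (μ.withDensity g) (s, a) p.2)) := by fun_prop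
  rw [infoGain_eq, lintegral_withDensity_eq_lintegral_mul _ hgm h1.lintegral_prod_right',
    lintegral_prod _ (by fun_prop)]
  refine lintegral_congr fun θ => ?_
  exact (lintegral_const_mul (g θ) (f := fun s' => bregman (M.likelihood (s, a) s' θ)
    (M.evidence (μ.withDensity g) (s, a) s')) (by fun_prop)).symm

end Densities

/-! ### Bounds on values -/

lemma abs_iSup_le {ι : Type*} [Nonempty ι] {u : ι → ℝ} {B : ℝ} (h : ∀ i, |u i| ≤ B) :
    |⨆ i, u i| ≤ B := by
  have hbdd : BddAbove (Set.range u) := ⟨B, by rintro _ ⟨i, rfl⟩; exact (abs_le.1 (h i)).2⟩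
  obtain ⟨i⟩ := ‹Nonempty ι›
  have : Nonempty ι := ⟨i⟩
  exact abs_le.2 ⟨(abs_le.1 (h i)).1.trans (le_ciSup hbdd i), ciSup_le fun i => (abs_le.1 (h i)).2⟩

lemma abs_Qaugm_le_of (h : M.BoundedReward μ r η γ R C) [IsProbabilityMeasure μ]
    {t : ℕ} (ht : ∀ s (g : Θ → ℝ≥0∞), IsDensity μ g →
      |M.Vaugm r η γ t s (μ.withDensity g)| ≤ valueBound R C γ t)
    (s : ℝ) {g : Θ → ℝ≥0∞} (hg : IsDensity μ g) (a : A) :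
    |M.Qaugm r η γ t s (μ.withDensity g) a| ≤ valueBound R C γ (t + 1) := by
  have := hg.isProbabilityMeasure
  have h1 := h.abs_le s a
  have h2 : |η * (M.infoGain (μ.withDensity g) s a).toReal| ≤ C := by
    have := ENNReal.toReal_mono ENNReal.coe_ne_top (h.infoGain_le (μ.withDensity g) this
      (withDensity_absolutelyContinuous _ _) s a)
    rw [ENNReal.toReal_mul, ENNReal.toReal_ofReal h.eta_nonneg, ENNReal.coe_toReal] at this
    rwa [abs_of_nonneg (mul_nonneg h.eta_nonneg ENNReal.toReal_nonneg)]
  have h3 : |∫ s', M.Vaugm r η γ t s' (bayes (μ.withDensity g) (M.likelihood (s, a) s'))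
      ∂(M.predictive (μ.withDensity g) s a)| ≤ valueBound R C γ t := by
    have hae : ∀ᵐ s' ∂(M.predictive (μ.withDensity g) s a),
        bayes (μ.withDensity g) (M.likelihood (s, a) s')
          = μ.withDensity (M.update μ g (s, a) s') := by
      rw [predictive_eq]
      exact (withDensity_absolutelyContinuous _ _).ae_le (bayes_eq_update hg (s, a))
    have hb : ∀ᵐ s' ∂(M.predictive (μ.withDensity g) s a),
        ‖M.Vaugm r η γ t s' (bayes (μ.withDensity g) (M.likelihood (s, a) s'))‖
          ≤ valueBound R C γ t := by
      filter_upwards [hae] with s' hs'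
      rw [hs']
      exact ht s' _ (isDensity_update hg.measurable _ _)
    -- This bound needs no measurability of the value, so it is available before measurability is
    -- proved.
    simpa using norm_integral_le_of_norm_le_const hb
  unfold Qaugm valueBound
  refine (abs_add_le _ _).trans (add_le_add ((abs_add_le _ _).trans (add_le_add h1 h2)) ?_)
  rw [abs_mul, abs_of_nonneg h.gamma_nonneg]
  exact mul_le_mul_of_nonneg_left h3 h.gamma_nonneg

lemma abs_Vaugm_le (h : M.BoundedReward μ r η γ R C) [Nonempty A] [IsProbabilityMeasure μ]
    (t : ℕ) (s : ℝ) {g : Θ → ℝ≥0∞} (hg : IsDensity μ g) :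
    |M.Vaugm r η γ t s (μ.withDensity g)| ≤ valueBound R C γ t := by
  induction t generalizing s g with
  | zero => simp [Vaugm, valueBound]
  | succ t ih => exact abs_iSup_le fun a => abs_Qaugm_le_of h (fun s g hg => ih s hg) s hg a

lemma abs_Qaugm_le (h : M.BoundedReward μ r η γ R C) [Nonempty A] [IsProbabilityMeasure μ]
    (t : ℕ) (s : ℝ) {g : Θ → ℝ≥0∞} (hg : IsDensity μ g) (a : A) :
    |M.Qaugm r η γ t s (μ.withDensity g) a| ≤ valueBound R C γ (t + 1) :=
  abs_Qaugm_le_of h (fun s _ hg => abs_Vaugm_le h t s hg) s hg a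

lemma Qaugm_le_Vaugm (h : M.BoundedReward μ r η γ R C) [Nonempty A] [IsProbabilityMeasure μ]
    (t : ℕ) (s : ℝ) {g : Θ → ℝ≥0∞} (hg : IsDensity μ g) (a : A) :
    M.Qaugm r η γ t s (μ.withDensity g) a ≤ M.Vaugm r η γ (t + 1) s (μ.withDensity g) :=
  le_ciSup (f := fun a => M.Qaugm r η γ t s (μ.withDensity g) a)
    ⟨valueBound R C γ (t + 1), by
      rintro _ ⟨a, rfl⟩; exact (abs_le.1 (abs_Qaugm_le h t s hg a)).2⟩ a

end Dynamics

/-! ### Semicontinuity and measurability of the value -/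

namespace Dynamics

/-- Measurability of a value function along measurable families of beliefs. -/
def IsMeasurableValue (μ : Measure Θ) (V : ℝ → Measure Θ → ℝ) : Prop :=
  ∀ {𝒴 : Type} [MeasurableSpace 𝒴] (S : 𝒴 → ℝ) (g : 𝒴 → Θ → ℝ≥0∞), Measurable S →
    Measurable (Function.uncurry g) → (∀ y, ∫⁻ θ, g y θ ∂μ = 1) →
    Measurable fun y => V (S y) (μ.withDensity (g y))

/-- Sequential lower semicontinuity of a value function in the density of the belief. -/
def IsLscValue (μ : Measure Θ) (V : ℝ → Measure Θ → ℝ) : Prop :=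
  ∀ (s : ℝ) (g : ℕ → Θ → ℝ≥0∞) (g' : Θ → ℝ≥0∞), (∀ n, IsDensity μ (g n)) → IsDensity μ g' →
    (∀ᵐ θ ∂μ, Tendsto (fun n => g n θ) atTop (𝓝 (g' θ))) →
    LiminfGE (fun n => V s (μ.withDensity (g n))) (V s (μ.withDensity g'))

variable {M : Dynamics A Θ} {μ : Measure Θ} {r : ℝ → A → ℝ} {η γ R : ℝ} {C : ℝ≥0}

lemma tendsto_likelihood_action (s : ℝ) {as : ℕ → A} {a : A} (ha : Tendsto as atTop (𝓝 a))
    (s' : ℝ) (θ : Θ) :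
    Tendsto (fun n => M.likelihood (s, as n) s' θ) atTop (𝓝 (M.likelihood (s, a) s' θ)) :=
  tendsto_gaussianPDF (((M.f θ).continuous.tendsto _).comp (tendsto_const_nhds.prodMk_nhds ha))
    tendsto_const_nhds (M.var_pos θ) s'

lemma tendsto_mul_likelihood (s : ℝ) {as : ℕ → A} {a : A} (ha : Tendsto as atTop (𝓝 a))
    (s' : ℝ) (θ : Θ) {u : ℕ → ℝ≥0∞} {x : ℝ≥0∞} (hu : Tendsto u atTop (𝓝 x)) :
    Tendsto (fun n => u n * M.likelihood (s, as n) s' θ) atTop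
      (𝓝 (x * M.likelihood (s, a) s' θ)) :=
  ENNReal.Tendsto.mul hu (Or.inr (M.likelihood_ne_top _ _ _))
    (tendsto_likelihood_action s ha s' θ) (Or.inl (M.likelihood_ne_zero _ _ _))

variable [IsProbabilityMeasure μ]

/-- Fatou on the product of parameters and next states, as the divergence integrand is nonnegative.
The one-sided bound suffices for measurability. -/
lemma liminfGE_infoGain (h : M.BoundedReward μ r η γ R C) (s : ℝ) {as : ℕ → A} {a : A}
    (ha : Tendsto as atTop (𝓝 a)) {g : ℕ → Θ → ℝ≥0∞} {g' : Θ → ℝ≥0∞}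
    (hg : ∀ n, IsDensity μ (g n)) (hg' : IsDensity μ g')
    (hlim : ∀ᵐ θ ∂μ, Tendsto (fun n => g n θ) atTop (𝓝 (g' θ)))
    (hE : ∀ᵐ s', Tendsto (fun n => M.evidence (μ.withDensity (g n)) (s, as n) s') atTop
      (𝓝 (M.evidence (μ.withDensity g') (s, a) s'))) :
    LiminfGE (fun n => η * (M.infoGain (μ.withDensity (g n)) s (as n)).toReal)
      (η * (M.infoGain (μ.withDensity g') s a).toReal) := by
  have hp := fun n => (hg n).isProbabilityMeasure
  have hp' := hg'.isProbabilityMeasure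
  -- Only the product is assumed bounded; for `η = 0` the information gain itself may be infinite.
  have e : ∀ b a, η * (M.infoGain b s a).toReal = (ENNReal.ofReal η * M.infoGain b s a).toReal := by
    intro b a
    rw [ENNReal.toReal_mul, ENNReal.toReal_ofReal h.eta_nonneg]
  simp only [e]
  refine LiminfGE.toReal (fun n => ne_top_of_le_ne_top ENNReal.coe_ne_top
    (h.infoGain_le _ (hp n) (withDensity_absolutelyContinuous _ _) _ _)) ?_
  have hm : ∀ (g : Θ → ℝ≥0∞) (a : A), IsDensity μ g → Measurable fun p : Θ × ℝ =>
      g p.1 * bregman (M.likelihood (s, a) p.2 p.1)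
        (M.evidence (μ.withDensity g) (s, a) p.2) := by
    intro g a hg
    have := hg.isProbabilityMeasure
    have hgm := hg.measurable
    have hE := M.measurable_evidence (μ.withDensity g) (s, a)
    fun_prop
  simp only [fun n => infoGain_withDensity (M := M) (hg n) s (as n),
    infoGain_withDensity (M := M) hg' s a]
  simp only [← fun n => lintegral_const_mul (μ := μ.prod volume) (ENNReal.ofReal η)
    (hm (g n) (as n) (hg n)),
    ← lintegral_const_mul (μ := μ.prod volume) (ENNReal.ofReal η) (hm g' a hg')]
  refine le_trans (lintegral_mono_ae ?_)
    (lintegral_liminf_le fun n => (hm (g n) (as n) (hg n)).const_mul _)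
  have h1 : ∀ᵐ p ∂(μ.prod (volume : Measure ℝ)), g' p.1 ≠ ∞ ∧
      Tendsto (fun n => g n p.1) atTop (𝓝 (g' p.1)) := by
    refine Measure.quasiMeasurePreserving_fst.ae (p := fun θ => g' θ ≠ ∞ ∧
      Tendsto (fun n => g n θ) atTop (𝓝 (g' θ))) ?_
    filter_upwards [ae_lt_top hg'.measurable (by simp [hg'.lintegral_eq_one]), hlim] with θ h h'
    exact ⟨h.ne, h'⟩
  have h2 : ∀ᵐ p ∂(μ.prod (volume : Measure ℝ)), M.evidence (μ.withDensity g') (s, a) p.2 ≠ ∞ ∧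
      Tendsto (fun n => M.evidence (μ.withDensity (g n)) (s, as n) p.2) atTop
      (𝓝 (M.evidence (μ.withDensity g') (s, a) p.2)) := by
    refine Measure.quasiMeasurePreserving_snd.ae
      (p := fun s' => M.evidence (μ.withDensity g') (s, a) s' ≠ ∞ ∧
      Tendsto (fun n => M.evidence (μ.withDensity (g n)) (s, as n) s') atTop
      (𝓝 (M.evidence (μ.withDensity g') (s, a) s'))) ?_
    filter_upwards [M.evidence_ae_ne_top (μ.withDensity g') (s, a), hE] with s' h h'
    exact ⟨h, h'⟩
  filter_upwards [h1, h2] with p hp1 hp2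
  have hb := tendsto_bregman (tendsto_likelihood_action (M := M) s ha p.2 p.1) hp2.2
    (M.likelihood_ne_top _ _ _) (M.evidence_ne_zero _ _ _) hp2.1
  have hbt : bregman (M.likelihood (s, a) p.2 p.1) (M.evidence (μ.withDensity g') (s, a) p.2)
      ≠ ∞ := ENNReal.mul_ne_top hp2.1 ENNReal.ofReal_ne_top
  exact (ENNReal.Tendsto.const_mul (ENNReal.Tendsto.mul hp1.2 (Or.inr hbt) hb (Or.inr hp1.1))
    (Or.inr ENNReal.ofReal_ne_top)).liminf_eq.ge

variable [Nonempty A]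

lemma liminfGE_Qaugm_of_evidence (h : M.BoundedReward μ r η γ R C) {t : ℕ}
    (hmeas : IsMeasurableValue μ (M.Vaugm r η γ t)) (hlsc : IsLscValue μ (M.Vaugm r η γ t))
    (s : ℝ) {as : ℕ → A} {a : A}
    (ha : Tendsto as atTop (𝓝 a)) {g : ℕ → Θ → ℝ≥0∞} {g' : Θ → ℝ≥0∞}
    (hg : ∀ n, IsDensity μ (g n)) (hg' : IsDensity μ g')
    (hlim : ∀ᵐ θ ∂μ, Tendsto (fun n => g n θ) atTop (𝓝 (g' θ)))
    (hE : ∀ᵐ s', Tendsto (fun n => M.evidence (μ.withDensity (g n)) (s, as n) s') atTop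
      (𝓝 (M.evidence (μ.withDensity g') (s, a) s'))) :
    LiminfGE (fun n => M.Qaugm r η γ t s (μ.withDensity (g n)) (as n))
      (M.Qaugm r η γ t s (μ.withDensity g') a) := by
  have hp := fun n => (hg n).isProbabilityMeasure
  have hp' := hg'.isProbabilityMeasure
  have hupd : ∀ (g : Θ → ℝ≥0∞) (a : A), IsDensity μ g →
      Measurable fun s' => M.Vaugm r η γ t s' (μ.withDensity (M.update μ g (s, a) s')) :=
    fun g a hg => hmeas _ _ measurable_id (measurable_update hg.measurable (s, a))
      fun s' => (isDensity_update hg.measurable (s, a) s').lintegral_eq_one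
  refine ((LiminfGE.of_tendsto (((h.continuous s).tendsto a).comp ha)).add
    (liminfGE_infoGain h s ha hg hg' hlim hE)).add (LiminfGE.const_mul ?_ h.gamma_nonneg)
  simp only [fun n => integral_predictive_eq (M := M) (hg n) s (as n) (M.Vaugm r η γ t),
    integral_predictive_eq (M := M) hg' s a (M.Vaugm r η γ t)]
  refine LiminfGE.integral (fun n => M.measurable_evidence _ _) (M.measurable_evidence _ _)
    (fun n => M.lintegral_evidence _ _) (M.lintegral_evidence _ _)
    (fun s' => M.evidence_ne_zero _ _ _) (fun n => hupd _ _ (hg n)) (hupd _ _ hg').aemeasurable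
    (fun n s' => abs_Vaugm_le h t s' (isDensity_update (hg n).measurable _ _))
    (fun s' => abs_Vaugm_le h t s' (isDensity_update hg'.measurable _ _)) hE ?_
  filter_upwards [hE, M.evidence_ae_ne_top (μ.withDensity g') (s, a)] with s' h1 h2
  refine hlsc s' _ _ (fun n => isDensity_update (hg n).measurable _ _)
    (isDensity_update hg'.measurable _ _) ?_
  filter_upwards [hlim] with θ hθ
  have h0 := M.evidence_ne_zero (μ.withDensity g') (s, a) s'
  simp only [fun n => evidence_withDensity (M := M) (μ := μ) (hg n).measurable (s, as n) s',
    evidence_withDensity (M := M) (μ := μ) hg'.measurable (s, a) s'] at h0 h1 h2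
  exact tendsto_normalize h0 h2 h1 (tendsto_mul_likelihood s ha s' θ hθ)

/-- Convergence of the evidence holds almost everywhere along a further subsequence of any
subsequence, being a marginal of convergent joint densities. -/
lemma liminfGE_Qaugm (h : M.BoundedReward μ r η γ R C) {t : ℕ}
    (hmeas : IsMeasurableValue μ (M.Vaugm r η γ t)) (hlsc : IsLscValue μ (M.Vaugm r η γ t))
    (s : ℝ) {as : ℕ → A} {a : A}
    (ha : Tendsto as atTop (𝓝 a)) {g : ℕ → Θ → ℝ≥0∞} {g' : Θ → ℝ≥0∞}
    (hg : ∀ n, IsDensity μ (g n)) (hg' : IsDensity μ g')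
    (hlim : ∀ᵐ θ ∂μ, Tendsto (fun n => g n θ) atTop (𝓝 (g' θ))) :
    LiminfGE (fun n => M.Qaugm r η γ t s (μ.withDensity (g n)) (as n))
      (M.Qaugm r η γ t s (μ.withDensity g') a) := by
  refine LiminfGE.of_subseq fun φ hφ => ?_
  have hm : ∀ (g : Θ → ℝ≥0∞) (a : A), IsDensity μ g →
      Measurable (Function.uncurry fun (s' : ℝ) θ => g θ * M.likelihood (s, a) s' θ) := by
    intro g a hg
    exact (hg.measurable.comp measurable_snd).mul (by fun_prop :
      Measurable fun p : ℝ × Θ => M.likelihood (s, a) p.1 p.2)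
  have hone : ∀ (g : Θ → ℝ≥0∞) (a : A), IsDensity μ g →
      ∫⁻ s', ∫⁻ θ, g θ * M.likelihood (s, a) s' θ ∂μ = 1 := by
    intro g a hg
    rw [M.lintegral_evidence_mul μ (s, a) hg.measurable, hg.lintegral_eq_one]
  obtain ⟨ψ, hψ, hae⟩ := exists_subseq_tendsto_marginal (μ := volume) (ν := μ)
    (fun n => hm (g (φ n)) (as (φ n)) (hg _)) (hm g' a hg')
    (fun n => hone (g (φ n)) (as (φ n)) (hg _)) (hone g' a hg')
    (ae_of_all _ fun s' => by
      filter_upwards [hlim] with θ hθ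
      exact tendsto_mul_likelihood s (ha.comp hφ.tendsto_atTop) s' θ (hθ.comp hφ.tendsto_atTop))
  have hφψ := (hφ.comp hψ).tendsto_atTop
  refine ⟨ψ, hψ, liminfGE_Qaugm_of_evidence h hmeas hlsc s (ha.comp hφψ)
    (g := fun n => g (φ (ψ n))) (fun n => hg _) hg' ?_ ?_⟩
  · filter_upwards [hlim] with θ hθ using hθ.comp hφψ
  · filter_upwards [hae] with s' hs'
    simpa only [Function.comp_apply, fun n => evidence_withDensity (M := M) (μ := μ) (hg n).measurable,
      evidence_withDensity (M := M) (μ := μ) hg'.measurable] using hs'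

lemma isLscValue_succ (h : M.BoundedReward μ r η γ R C) {t : ℕ}
    (hmeas : IsMeasurableValue μ (M.Vaugm r η γ t)) (hlsc : IsLscValue μ (M.Vaugm r η γ t)) :
    IsLscValue μ (M.Vaugm r η γ (t + 1)) := by
  intro s g g' hg hg' hlim c hc
  obtain ⟨a, ha⟩ := exists_lt_of_lt_ciSup hc
  filter_upwards [liminfGE_Qaugm h hmeas hlsc s (tendsto_const_nhds (x := a)) hg hg' hlim c ha]
    with n hn
  exact hn.trans_le (Qaugm_le_Vaugm h t s (hg n) a)

/-- For a constant sequence of densities, `liminfGE_Qaugm` is lower semicontinuity in the action, so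
a dense sequence of actions attains the same supremum. -/
lemma Vaugm_succ_eq_iSup_dense (h : M.BoundedReward μ r η γ R C) {t : ℕ}
    (hmeas : IsMeasurableValue μ (M.Vaugm r η γ t)) (hlsc : IsLscValue μ (M.Vaugm r η γ t))
    (s : ℝ) {g : Θ → ℝ≥0∞} (hg : IsDensity μ g) :
    M.Vaugm r η γ (t + 1) s (μ.withDensity g)
      = ⨆ n, M.Qaugm r η γ t s (μ.withDensity g) (TopologicalSpace.denseSeq A n) := by
  have hbdd : BddAbove (Set.range fun n =>
      M.Qaugm r η γ t s (μ.withDensity g) (TopologicalSpace.denseSeq A n)) :=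
    ⟨valueBound R C γ (t + 1), by
      rintro _ ⟨n, rfl⟩; exact (abs_le.1 (abs_Qaugm_le h t s hg _)).2⟩
  refine le_antisymm (ciSup_le fun a => le_of_forall_lt fun c hc => ?_)
    (ciSup_le fun n => Qaugm_le_Vaugm h t s hg _)
  obtain ⟨as, has, hlim⟩ := mem_closure_iff_seq_limit.1 (TopologicalSpace.denseRange_denseSeq A a)
  obtain ⟨n, hn⟩ := (liminfGE_Qaugm h hmeas hlsc s hlim (g := fun _ => g) (fun _ => hg) hg
    (ae_of_all _ fun _ => tendsto_const_nhds) c hc).exists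
  obtain ⟨k, hk⟩ := has n
  simp only [← hk] at hn
  exact hn.trans_le (le_ciSup hbdd k)

lemma isMeasurableValue_succ (h : M.BoundedReward μ r η γ R C) {t : ℕ}
    (hmeas : IsMeasurableValue μ (M.Vaugm r η γ t)) (hlsc : IsLscValue μ (M.Vaugm r η γ t)) :
    IsMeasurableValue μ (M.Vaugm r η γ (t + 1)) := by
  intro 𝒴 _ S g hS hg hg1
  have hd : ∀ y, IsDensity μ (g y) := fun y => ⟨hg.comp measurable_prodMk_left, hg1 y⟩
  have hp := fun y => (hd y).isProbabilityMeasure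
  simp only [fun y => Vaugm_succ_eq_iSup_dense h hmeas hlsc (S y) (hd y)]
  refine Measurable.iSup fun n => ?_
  set a := TopologicalSpace.denseSeq A n
  have hE := measurable_evidence_uncurry (M := M) (μ := μ) hg hS a
  refine ((h.measurable.comp (hS.prodMk measurable_const)).add (Measurable.const_mul ?_ η)).add
    (Measurable.const_mul ?_ γ)
  · refine Measurable.ennreal_toReal ?_
    simp only [fun y => infoGain_withDensity (M := M) (hd y) (S y) a]
    refine Measurable.lintegral_prod_right' (f := fun p : 𝒴 × (Θ × ℝ) =>
      g p.1 p.2.1 * bregman (M.likelihood (S p.1, a) p.2.2 p.2.1)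
        (M.evidence (μ.withDensity (g p.1)) (S p.1, a) p.2.2)) ?_
    have h1 : Measurable (fun p : 𝒴 × (Θ × ℝ) => g p.1 p.2.1) :=
      hg.comp (measurable_fst.prodMk measurable_snd.fst)
    have h2 : Measurable (fun p : 𝒴 × (Θ × ℝ) => M.likelihood (S p.1, a) p.2.2 p.2.1) := by
      fun_prop
    have h3 : Measurable (fun p : 𝒴 × (Θ × ℝ) =>
        M.evidence (μ.withDensity (g p.1)) (S p.1, a) p.2.2) :=
      hE.comp (f := fun p : 𝒴 × (Θ × ℝ) => (p.1, p.2.2))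
        (measurable_fst.prodMk measurable_snd.snd)
    exact h1.mul (measurable_bregman h2 h3)
  · simp only [fun y => integral_predictive_eq (M := M) (hd y) (S y) a (M.Vaugm r η γ t)]
    refine StronglyMeasurable.measurable (StronglyMeasurable.integral_prod_right
      (f := fun y s' => (M.evidence (μ.withDensity (g y)) (S y, a) s').toReal
        * M.Vaugm r η γ t s' (μ.withDensity (M.update μ (g y) (S y, a) s'))) ?_)
    refine Measurable.stronglyMeasurable (hE.ennreal_toReal.mul ?_)
    -- The next state joins the parameter space; this is why `IsMeasurableValue` quantifies over all
    -- `𝒴`.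
    exact hmeas (𝒴 := 𝒴 × ℝ) Prod.snd (fun p => M.update μ (g p.1) (S p.1, a) p.2) measurable_snd
      (measurable_update_uncurry hg hS a)
      fun p => (isDensity_update (hd p.1).measurable _ _).lintegral_eq_one

/-- The induction must be simultaneous: Fatou needs measurability at `t`, and the countable supremum
needs semicontinuity of the action values, hence of the value at `t`. -/
lemma isMeasurableValue_and_isLscValue (h : M.BoundedReward μ r η γ R C) (t : ℕ) :
    IsMeasurableValue μ (M.Vaugm r η γ t) ∧ IsLscValue μ (M.Vaugm r η γ t) := by
  induction t with
  | zero =>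
    refine ⟨fun S g _ _ _ => ?_, fun s g g' _ _ _ => ?_⟩
    · simp only [Vaugm, measurable_const]
    · simpa only [Vaugm] using LiminfGE.of_tendsto tendsto_const_nhds
  | succ t ih => exact ⟨isMeasurableValue_succ h ih.1 ih.2, isLscValue_succ h ih.1 ih.2⟩

lemma measurable_Vaugm_update (h : M.BoundedReward μ r η γ R C) (t : ℕ) {g : Θ → ℝ≥0∞}
    (hg : IsDensity μ g) (x : ℝ × A) :
    Measurable fun s' => M.Vaugm r η γ t s' (μ.withDensity (M.update μ g x s')) :=
  (isMeasurableValue_and_isLscValue h t).1 _ _ measurable_id (measurable_update hg.measurable x)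
    fun s' => (isDensity_update hg.measurable x s').lintegral_eq_one

end Dynamics

/-! ### Values at concentrating beliefs -/

lemma LiminfGE.tendsto {u : ℕ → ℝ} {x : ℝ} (h : LiminfGE u x)
    (h' : LiminfGE (fun n => -u n) (-x)) : Tendsto u atTop (𝓝 x) := by
  refine tendsto_order.2 ⟨h, fun c hc => ?_⟩
  filter_upwards [h' (-c) (by linarith)] with n hn
  linarith

/-- Bounded functions weighted by convergent densities. -/
lemma tendsto_integral_toReal_mul {α : Type*} [MeasurableSpace α] {μ : Measure α}
    {m : ℕ → α → ℝ≥0∞} {m' : α → ℝ≥0∞} {W : ℕ → α → ℝ} {W' : α → ℝ} {B : ℝ}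
    (hm : ∀ n, Measurable (m n)) (hm' : Measurable m') (hm1 : ∀ n, ∫⁻ x, m n x ∂μ = 1)
    (hm1' : ∫⁻ x, m' x ∂μ = 1) (hm0 : ∀ x, m' x ≠ 0)
    (hW : ∀ n, Measurable (W n)) (hB : ∀ n x, |W n x| ≤ B)
    (hB' : ∀ x, |W' x| ≤ B) (hmlim : ∀ᵐ x ∂μ, Tendsto (fun n => m n x) atTop (𝓝 (m' x)))
    (hWlim : ∀ᵐ x ∂μ, Tendsto (fun n => W n x) atTop (𝓝 (W' x))) :
    Tendsto (fun n => ∫ x, (m n x).toReal * W n x ∂μ) atTop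
      (𝓝 (∫ x, (m' x).toReal * W' x ∂μ)) := by
  -- The limit inherits measurability, so none has to be proved for `Vstar`.
  have hW' : AEMeasurable W' μ := aemeasurable_of_tendsto_metrizable_ae' (fun n =>
    (hW n).aemeasurable) hWlim
  refine LiminfGE.tendsto (LiminfGE.integral hm hm' hm1 hm1' hm0 hW hW' hB hB' hmlim
    (hWlim.mono fun _ => LiminfGE.of_tendsto)) ?_
  have h := LiminfGE.integral hm hm' hm1 hm1' hm0 (W := fun n x => -W n x) (W' := fun x => -W' x)
    (B := B) (fun n => (hW n).neg) hW'.neg (fun n x => by rw [abs_neg]; exact hB n x)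
    (fun x => by rw [abs_neg]; exact hB' x) hmlim
    (hWlim.mono fun _ h => LiminfGE.of_tendsto h.neg)
  simpa only [mul_neg, integral_neg] using h

namespace Dynamics

lemma integral_transition_eq {M : Dynamics A Θ} (s : ℝ) (a : A) (θ : Θ) (V : ℝ → ℝ) :
    ∫ s', V s' ∂(M.transition s a θ) = ∫ s', (M.likelihood (s, a) s' θ).toReal * V s' := by
  rw [transition_apply, integral_withDensity_eq_integral_toReal_smul (by fun_prop)
    (ae_of_all _ fun s' => (M.likelihood_ne_top _ _ _).lt_top)]
  simp only [smul_eq_mul]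

/-! ### Bounds for the problem with known dynamics -/

section KnownDynamics

variable {M : Dynamics A Θ} {μ : Measure Θ} {r : ℝ → A → ℝ} {η γ R : ℝ} {C : ℝ≥0} {θ₀ : Θ}

/-- The value of an action with known dynamics. -/
def Qstar (M : Dynamics A Θ) (r : ℝ → A → ℝ) (γ : ℝ) (θ : Θ) (t : ℕ) (s : ℝ) (a : A) : ℝ :=
  r s a + γ * ∫ s', M.Vstar r γ θ t s' ∂(M.transition s a θ)

lemma abs_Qstar_le_of (h : M.BoundedReward μ r η γ R C) {t : ℕ}
    (ht : ∀ s, |M.Vstar r γ θ₀ t s| ≤ valueBound R C γ t) (s : ℝ) (a : A) :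
    |M.Qstar r γ θ₀ t s a| ≤ valueBound R C γ (t + 1) := by
  have h1 := h.abs_le s a
  have h2 : |∫ s', M.Vstar r γ θ₀ t s' ∂(M.transition s a θ₀)| ≤ valueBound R C γ t := by
    have hb : ∀ᵐ s' ∂(M.transition s a θ₀), ‖M.Vstar r γ θ₀ t s'‖ ≤ valueBound R C γ t :=
      ae_of_all _ ht
    simpa using norm_integral_le_of_norm_le_const hb
  have h3 : |γ * ∫ s', M.Vstar r γ θ₀ t s' ∂(M.transition s a θ₀)|
      ≤ γ * valueBound R C γ t := by
    rw [abs_mul, abs_of_nonneg h.gamma_nonneg]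
    exact mul_le_mul_of_nonneg_left h2 h.gamma_nonneg
  unfold Qstar valueBound
  refine (abs_add_le _ _).trans (add_le_add (h1.trans ?_) h3)
  linarith [C.2]

lemma abs_Vstar_le (h : M.BoundedReward μ r η γ R C) [Nonempty A] (t : ℕ) (s : ℝ) :
    |M.Vstar r γ θ₀ t s| ≤ valueBound R C γ t := by
  induction t generalizing s with
  | zero => simp [Vstar, valueBound]
  | succ t ih => exact abs_iSup_le fun a => abs_Qstar_le_of h ih s a

lemma Qstar_le_Vstar (h : M.BoundedReward μ r η γ R C) [Nonempty A] (t : ℕ) (s : ℝ) (a : A) :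
    M.Qstar r γ θ₀ t s a ≤ M.Vstar r γ θ₀ (t + 1) s :=
  le_ciSup (f := fun a => M.Qstar r γ θ₀ t s a)
    ⟨valueBound R C γ (t + 1), by
      rintro _ ⟨a, rfl⟩
      exact (abs_le.1 (abs_Qstar_le_of h (abs_Vstar_le h t) s a)).2⟩ a

end KnownDynamics

variable {Θ : Type*} [MetricSpace Θ] [MeasurableSpace Θ]
  {M : Dynamics A Θ} {μ : Measure Θ} {r : ℝ → A → ℝ} {η γ R : ℝ} {C : ℝ≥0} {θ₀ : Θ}

/-- The mean distance (cut off at `1`) to `θ₀` under a belief. -/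
abbrev dispersion (b : Measure Θ) (θ₀ : Θ) : ℝ≥0∞ := ∫⁻ θ, min 1 (edist θ θ₀) ∂b

variable [BorelSpace Θ]

@[fun_prop]
lemma measurable_min_edist (θ₀ : Θ) : Measurable fun θ => min 1 (edist θ θ₀) :=
  measurable_const.min (by fun_prop)

lemma dispersion_withDensity {g : Θ → ℝ≥0∞} (hg : Measurable g) :
    dispersion (μ.withDensity g) θ₀ = ∫⁻ θ, g θ * min 1 (edist θ θ₀) ∂μ :=
  lintegral_withDensity_eq_lintegral_mul _ hg (by fun_prop)

/-- The `L¹` gap of a mixture is at most the mean gap of its components. That gap is bounded by 2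
and, by Scheffé, vanishes as `(n, θ)` tends to `(∞, θ₀)`. -/
lemma tendsto_evidence (hA : IsCompact A) (hf : ContinuousAt M.f θ₀)
    (hvar : ContinuousAt M.var θ₀) {b : ℕ → Measure Θ} [∀ n, IsProbabilityMeasure (b n)]
    (hb : Tendsto (fun n => dispersion (b n) θ₀) atTop (𝓝 0))
    (s : ℝ) {as : ℕ → A} {a : A} (ha : Tendsto as atTop (𝓝 a)) :
    Tendsto (fun n => ∫⁻ s', gap (M.evidence (b n) (s, as n) s') (M.likelihood (s, a) s' θ₀))
      atTop (𝓝 0) := by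
  have hT : Tendsto (fun p : ℕ × Θ => ∫⁻ s', gap (M.likelihood (s, as p.1) s' p.2)
      (M.likelihood (s, a) s' θ₀)) (atTop ×ˢ 𝓝 θ₀) (𝓝 0) := by
    refine tendsto_lintegral_gap (fun p => by fun_prop) (by fun_prop)
      (fun p => M.lintegral_likelihood _ _) (M.lintegral_likelihood _ _) (ae_of_all _ fun s' => ?_)
    exact tendsto_gaussianPDF (M.tendsto_f hA hf s ha) (hvar.tendsto.comp tendsto_snd)
      (M.var_pos θ₀) s'
  have hlim := tendsto_lintegral_of_concentrate hb (T := fun n θ => ∫⁻ s',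
    gap (M.likelihood (s, as n) s' θ) (M.likelihood (s, a) s' θ₀)) (C := 2) (by simp)
    (fun n θ => ?_) hT
  · refine tendsto_of_tendsto_of_tendsto_of_le_of_le tendsto_const_nhds hlim
      (fun _ => zero_le) fun n => ?_
    have hm : Measurable (fun p : ℝ × Θ => gap (M.likelihood (s, as n) p.1 p.2)
      (M.likelihood (s, a) p.1 θ₀)) := by fun_prop
    calc ∫⁻ s', gap (M.evidence (b n) (s, as n) s') (M.likelihood (s, a) s' θ₀)
        ≤ ∫⁻ s', ∫⁻ θ, gap (M.likelihood (s, as n) s' θ) (M.likelihood (s, a) s' θ₀) ∂(b n) := by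
          refine lintegral_mono fun s' => ?_
          have := gap_lintegral_le (μ := b n) (f := fun θ => M.likelihood (s, as n) s' θ)
            (g := fun _ => M.likelihood (s, a) s' θ₀) (by fun_prop) measurable_const
          simpa [evidence] using this
      _ = _ := lintegral_lintegral_swap hm.aemeasurable
  · calc ∫⁻ s', gap (M.likelihood (s, as n) s' θ) (M.likelihood (s, a) s' θ₀)
        ≤ ∫⁻ s', M.likelihood (s, as n) s' θ + M.likelihood (s, a) s' θ₀ :=
          lintegral_mono fun s' => gap_le_add _ _
      _ = 2 := by
          rw [lintegral_add_left (by fun_prop), M.lintegral_likelihood, M.lintegral_likelihood,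
            one_add_one_eq_two]

lemma tendsto_eta_mul_infoGain (h : M.BoundedReward μ r η γ R C) (hA : IsCompact A)
    (hf : ContinuousAt M.f θ₀) (hvar : ContinuousAt M.var θ₀) {g : ℕ → Θ → ℝ≥0∞}
    (hg : ∀ n, IsDensity μ (g n))
    (hb : Tendsto (fun n => dispersion (μ.withDensity (g n)) θ₀) atTop (𝓝 0))
    (s : ℝ) {as : ℕ → A} {a : A} (ha : Tendsto as atTop (𝓝 a)) :
    Tendsto (fun n => η * (M.infoGain (μ.withDensity (g n)) s (as n)).toReal) atTop (𝓝 0) := by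
  rcases h.eta_nonneg.eq_or_lt with h0 | h0
  · simp [← h0]
  have hp := fun n => (hg n).isProbabilityMeasure
  have hη : ENNReal.ofReal η ≠ 0 := (ENNReal.ofReal_pos.2 h0).ne'
  have hlim := M.tendsto_infoGain hA hf hvar (C := C / ENNReal.ofReal η)
    (ENNReal.div_ne_top ENNReal.coe_ne_top hη) (prior := μ) (fun b hb hac s a =>
      (ENNReal.le_div_iff_mul_le (Or.inl hη) (Or.inl ENNReal.ofReal_ne_top)).2
        (by rw [mul_comm]; exact h.infoGain_le b hb hac s a))
    (fun n => withDensity_absolutelyContinuous _ _) hb s ha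
  simpa using ((ENNReal.tendsto_toReal ENNReal.zero_ne_top).comp hlim).const_mul η

variable [IsProbabilityMeasure μ]

lemma dispersion_update {g : Θ → ℝ≥0∞} (hg : IsDensity μ g) (x : ℝ × A) (s' : ℝ)
    (hE : M.evidence (μ.withDensity g) x s' ≠ ∞) :
    dispersion (μ.withDensity (M.update μ g x s')) θ₀ = (M.evidence (μ.withDensity g) x s')⁻¹
      * ∫⁻ θ, g θ * min 1 (edist θ θ₀) * M.likelihood x s' θ ∂μ := by
  have := hg.isProbabilityMeasure
  have hgm := hg.measurable
  have h0 := M.evidence_ne_zero (μ.withDensity g) x s'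
  rw [evidence_withDensity hgm] at hE h0 ⊢
  rw [dispersion_withDensity (isDensity_update hgm x s').measurable, update,
    normalize_of_ne h0 hE, ← lintegral_const_mul _ (by fun_prop)]
  refine lintegral_congr fun θ => ?_
  ring

/-- Along a subsequence, concentrating beliefs still concentrate after the next transition, for
almost every next state. -/
lemma exists_subseq_update (hA : IsCompact A) (hf : ContinuousAt M.f θ₀)
    (hvar : ContinuousAt M.var θ₀) {g : ℕ → Θ → ℝ≥0∞} (hg : ∀ n, IsDensity μ (g n))
    (hb : Tendsto (fun n => dispersion (μ.withDensity (g n)) θ₀) atTop (𝓝 0))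
    (s : ℝ) {as : ℕ → A} {a : A} (ha : Tendsto as atTop (𝓝 a)) :
    ∃ φ : ℕ → ℕ, StrictMono φ ∧ ∀ᵐ s',
      Tendsto (fun n => M.evidence (μ.withDensity (g (φ n))) (s, as (φ n)) s') atTop
        (𝓝 (M.likelihood (s, a) s' θ₀)) ∧
      Tendsto (fun n => dispersion (μ.withDensity (M.update μ (g (φ n)) (s, as (φ n)) s')) θ₀)
        atTop (𝓝 0) := by
  have hp := fun n => (hg n).isProbabilityMeasure
  have hgm := fun n => (hg n).measurable
  have h1 := M.tendsto_evidence hA hf hvar hb s ha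
  -- The dispersion of the updated belief before division by the evidence. Its integral over `s'` is
  -- the current dispersion, so it tends to 0 in `L¹`.
  set u : ℕ → ℝ → ℝ≥0∞ := fun n s' =>
    ∫⁻ θ, g n θ * min 1 (edist θ θ₀) * M.likelihood (s, as n) s' θ ∂μ with hu
  have hum : ∀ n, Measurable (u n) := fun n =>
    Measurable.lintegral_prod_right' (f := fun p : ℝ × Θ =>
      g n p.2 * min 1 (edist p.2 θ₀) * M.likelihood (s, as n) p.1 p.2)
      ((((hgm n).mul (measurable_min_edist θ₀)).comp measurable_snd).mul (by fun_prop))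
  have h2 : Tendsto (fun n => ∫⁻ s', u n s') atTop (𝓝 0) := by
    refine hb.congr fun n => ?_
    rw [dispersion_withDensity (hgm n)]
    exact (M.lintegral_evidence_mul μ (s, as n) ((hgm n).mul (measurable_min_edist θ₀))).symm
  have hgapm : ∀ n, Measurable fun s' => gap (M.evidence (μ.withDensity (g n)) (s, as n) s')
      (M.likelihood (s, a) s' θ₀) := fun n =>
    measurable_gap (M.measurable_evidence _ _) (by fun_prop)
  -- Summing the two quantities yields one subsequence that serves both.
  have h3 : Tendsto (fun n => ∫⁻ s', (gap (M.evidence (μ.withDensity (g n)) (s, as n) s')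
      (M.likelihood (s, a) s' θ₀) + u n s')) atTop (𝓝 0) := by
    simp only [fun n => lintegral_add_left (μ := volume) (hgapm n) (u n)]
    simpa using h1.add h2
  obtain ⟨φ, hφ, hae⟩ := exists_subseq_tendsto_zero_ae (fun n => (hgapm n).add (hum n)) h3
  refine ⟨φ, hφ, ?_⟩
  have hfin : ∀ᵐ s', ∀ n, M.evidence (μ.withDensity (g n)) (s, as n) s' ≠ ∞ :=
    ae_all_iff.2 fun n => M.evidence_ae_ne_top _ _
  filter_upwards [hae, hfin] with s' hs' hs'fin
  have hE : Tendsto (fun n => M.evidence (μ.withDensity (g (φ n))) (s, as (φ n)) s') atTop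
      (𝓝 (M.likelihood (s, a) s' θ₀)) :=
    tendsto_of_gap_tendsto_zero (tendsto_of_tendsto_of_tendsto_of_le_of_le tendsto_const_nhds hs'
      (fun _ => zero_le) fun _ => le_self_add) (M.likelihood_ne_top _ _ _)
  have hU : Tendsto (fun n => u (φ n) s') atTop (𝓝 0) :=
    tendsto_of_tendsto_of_tendsto_of_le_of_le tendsto_const_nhds hs'
      (fun _ => zero_le) fun _ => le_add_self
  refine ⟨hE, ?_⟩
  simp only [fun n => dispersion_update (M := M) (θ₀ := θ₀) (hg (φ n)) (s, as (φ n)) s'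
    (hs'fin (φ n))]
  have := ENNReal.Tendsto.mul (tendsto_inv_iff.2 hE)
    (Or.inl (ENNReal.inv_ne_zero.2 (M.likelihood_ne_top _ _ _))) hU
    (Or.inr (ENNReal.inv_ne_top.2 (M.likelihood_ne_zero _ _ _)))
  simpa using this

variable [Nonempty A]

/-- Almost everywhere convergence along sub-subsequences is enough, since the limit does not depend
on them. The actions vary with `n` so that near-optimal ones can be inserted later. -/
lemma tendsto_Qaugm (h : M.BoundedReward μ r η γ R C) (hA : IsCompact A)
    (hf : ContinuousAt M.f θ₀) (hvar : ContinuousAt M.var θ₀) {t : ℕ}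
    (ht : ∀ (s : ℝ) (g : ℕ → Θ → ℝ≥0∞), (∀ n, IsDensity μ (g n)) →
      Tendsto (fun n => dispersion (μ.withDensity (g n)) θ₀) atTop (𝓝 0) →
      Tendsto (fun n => M.Vaugm r η γ t s (μ.withDensity (g n))) atTop (𝓝 (M.Vstar r γ θ₀ t s)))
    {g : ℕ → Θ → ℝ≥0∞} (hg : ∀ n, IsDensity μ (g n))
    (hb : Tendsto (fun n => dispersion (μ.withDensity (g n)) θ₀) atTop (𝓝 0))
    (s : ℝ) {as : ℕ → A} {a : A} (ha : Tendsto as atTop (𝓝 a)) :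
    Tendsto (fun n => M.Qaugm r η γ t s (μ.withDensity (g n)) (as n)) atTop
      (𝓝 (M.Qstar r γ θ₀ t s a)) := by
  refine tendsto_of_subseq_tendsto fun ns hns => ?_
  obtain ⟨φ, hφ, hae⟩ := M.exists_subseq_update hA hf hvar (g := fun n => g (ns n))
    (fun n => hg _) (hb.comp hns) s (ha.comp hns)
  have hlim := hns.comp hφ.tendsto_atTop
  refine ⟨φ, ?_⟩
  have hp := fun n => (hg n).isProbabilityMeasure
  have h1 := ((h.continuous s).tendsto a).comp (ha.comp hlim)
  have h2 := tendsto_eta_mul_infoGain h hA hf hvar (g := fun n => g (ns (φ n))) (fun n => hg _)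
    (hb.comp hlim) s (ha.comp hlim)
  have h3 : Tendsto (fun n => ∫ s', M.Vaugm r η γ t s' (bayes (μ.withDensity (g (ns (φ n))))
      (M.likelihood (s, as (ns (φ n))) s')) ∂(M.predictive (μ.withDensity (g (ns (φ n)))) s
      (as (ns (φ n))))) atTop (𝓝 (∫ s', M.Vstar r γ θ₀ t s' ∂(M.transition s a θ₀))) := by
    simp only [fun n => integral_predictive_eq (M := M) (hg (ns (φ n))) s (as (ns (φ n)))
      (M.Vaugm r η γ t), integral_transition_eq]
    refine tendsto_integral_toReal_mul (B := valueBound R C γ t)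
      (fun n => M.measurable_evidence _ _) (by fun_prop)
      (fun n => M.lintegral_evidence _ _) (M.lintegral_likelihood _ _)
      (fun s' => M.likelihood_ne_zero _ _ _)
      (fun n => measurable_Vaugm_update h t (hg _) _)
      (fun n s' => abs_Vaugm_le h t s' (isDensity_update (hg _).measurable _ _))
      (fun s' => abs_Vstar_le h t s') ?_ ?_
    · filter_upwards [hae] with s' hs' using hs'.1
    · filter_upwards [hae] with s' hs'
      exact ht s' _ (fun n => isDensity_update (hg _).measurable _ _) hs'.2
  have := (h1.add h2).add (h3.const_mul γ)
  rw [add_zero] at this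
  exact this

lemma tendsto_Vaugm (h : M.BoundedReward μ r η γ R C) (hA : IsCompact A)
    (hf : ContinuousAt M.f θ₀) (hvar : ContinuousAt M.var θ₀) (t : ℕ) (s : ℝ)
    (g : ℕ → Θ → ℝ≥0∞) (hg : ∀ n, IsDensity μ (g n))
    (hb : Tendsto (fun n => dispersion (μ.withDensity (g n)) θ₀) atTop (𝓝 0)) :
    Tendsto (fun n => M.Vaugm r η γ t s (μ.withDensity (g n))) atTop
      (𝓝 (M.Vstar r γ θ₀ t s)) := by
  induction t generalizing s g with
  | zero => simp [Vaugm, Vstar]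
  | succ t ih =>
    refine tendsto_order.2 ⟨fun c hc => ?_, fun c hc => ?_⟩
    · obtain ⟨a, hac⟩ := exists_lt_of_lt_ciSup hc
      filter_upwards [(tendsto_Qaugm h hA hf hvar ih hg hb s
        (tendsto_const_nhds (x := a))).eventually_const_lt hac] with n hn
      exact hn.trans_le (Qaugm_le_Vaugm h t s (hg n) a)
    · by_contra hcon
      -- The slack between `d` and `c` allows near-maximizing actions, as the supremum need not be
      -- attained. A limit point of them would have `Qstar` at least `d`, above the optimum.
      obtain ⟨d, hd, hdc⟩ := exists_between hc
      obtain ⟨φ, hφ, hle⟩ := extraction_of_frequently_atTop (not_eventually.1 hcon)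
      have hex : ∀ n, ∃ a, d < M.Qaugm r η γ t s (μ.withDensity (g (φ n))) a := fun n =>
        exists_lt_of_lt_ciSup (hdc.trans_le (not_lt.1 (hle n)))
      choose as has using hex
      have : CompactSpace A := isCompact_iff_compactSpace.1 hA
      obtain ⟨a, ψ, hψ, hlim⟩ := CompactSpace.tendsto_subseq as
      have hQ := tendsto_Qaugm h hA hf hvar ih (g := fun n => g (φ (ψ n))) (fun n => hg _)
        (hb.comp (hφ.comp hψ).tendsto_atTop) s hlim
      have h1 : d ≤ M.Qstar r γ θ₀ t s a :=
        ge_of_tendsto' hQ fun n => (has (ψ n)).le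
      exact absurd hd (not_lt.2 (h1.trans (Qstar_le_Vstar h t s a)))

end Dynamics

/-! ### The posterior is almost surely a probability measure -/

namespace Dynamics

section Data

variable {M : Dynamics A Θ} {θ₀ : Θ} {Ω : Type*} [MeasurableSpace Ω] {P : Measure Ω}
  {X : ℕ → Ω → ℝ × A} {Y : ℕ → Ω → ℝ}

/-- The likelihood ratio of `θ` against `θ₀` for one transition. -/
def likelihoodRatio (M : Dynamics A Θ) (θ₀ θ : Θ) (x : ℝ × A) (s' : ℝ) : ℝ≥0∞ :=
  M.likelihood x s' θ / M.likelihood x s' θ₀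

@[fun_prop]
lemma measurable_likelihoodRatio {α : Type*} [MeasurableSpace α] {x : α → ℝ × A} {y : α → ℝ}
    {θ : α → Θ} (hx : Measurable x) (hy : Measurable y) (hθ : Measurable θ) :
    Measurable (fun p => M.likelihoodRatio θ₀ (θ p) (x p) (y p)) :=
  (M.measurable_likelihood hx hy hθ).div (M.measurable_likelihood hx hy measurable_const)

lemma measurable_f_apply {α : Type*} [MeasurableSpace α] {x : α → ℝ × A}
    (hx : Measurable x) (θ : Θ) : Measurable (fun p => M.f θ (x p)) :=
  (M.f θ).continuous.measurable.comp hx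

/-- The noise density cancels the denominator and leaves a translate of the density at `θ`. -/
lemma lintegral_likelihoodRatio (θ : Θ) (x : ℝ × A) :
    ∫⁻ e, M.likelihoodRatio θ₀ θ x (M.f θ₀ x + e) ∂(gaussianReal 0 (M.var θ₀)) = 1 := by
  have hm : Measurable fun e => M.likelihoodRatio θ₀ θ x (M.f θ₀ x + e) := by fun_prop
  rw [gaussianReal_of_var_ne_zero _ (M.var_pos θ₀).ne',
    lintegral_withDensity_eq_lintegral_mul _ (measurable_gaussianPDF _ _) hm]
  have e : ∀ e, (gaussianPDF 0 (M.var θ₀) * fun e => M.likelihoodRatio θ₀ θ x (M.f θ₀ x + e)) e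
      = M.likelihood x (M.f θ₀ x + e) θ := by
    intro e
    have h : gaussianPDF 0 (M.var θ₀) e = M.likelihood x (M.f θ₀ x + e) θ₀ := by
      simp only [likelihood, gaussianPDF]
      rw [add_comm, gaussianPDFReal_add, sub_self]
    rw [Pi.mul_apply, h, likelihoodRatio, ENNReal.mul_div_cancel (M.likelihood_ne_zero _ _ _)
      (M.likelihood_ne_top _ _ _)]
  simp only [e]
  rw [lintegral_add_left_eq_self (fun s' => M.likelihood x s' θ), M.lintegral_likelihood]

variable [IsProbabilityMeasure P]

/-- The likelihood ratio of the data has mean one under the true model. -/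
lemma lintegral_prod_likelihoodRatio (h : M.IsTrueModel θ₀ P X Y) (θ : Θ) (n : ℕ) :
    ∫⁻ ω, ∏ i ∈ Finset.range n, M.likelihoodRatio θ₀ θ (X i ω) (Y i ω) ∂P = 1 := by
  induction n with
  | zero => simp
  | succ n ih =>
    have hX := h.measurable_X
    have hY := h.measurable_Y
    set U : Ω → ℝ := fun ω => Y n ω - M.f θ₀ (X n ω) with hU
    set Z : Ω → (Fin (n + 1) → ℝ × A) × (Fin n → ℝ) :=
      fun ω => ((fun j : Fin (n + 1) => X j ω), (fun j : Fin n => Y j ω)) with hZ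
    have mU : Measurable U := (hY n).sub (measurable_f_apply (hX n) θ₀)
    have mZ : Measurable Z := (measurable_pi_lambda _ fun j : Fin (n + 1) => hX j).prodMk
      (measurable_pi_lambda _ fun j : Fin n => hY j)
    set ρ : (Fin (n + 1) → ℝ × A) × (Fin n → ℝ) → ℝ≥0∞ :=
      fun z => ∏ i : Fin n, M.likelihoodRatio θ₀ θ (z.1 i.castSucc) (z.2 i) with hρ
    have mρ : Measurable ρ := by fun_prop
    -- The last factor depends on the past only through the current pair, and on fresh independent
    -- noise; integrating the noise out first turns it into 1.
    set F : ℝ × ((Fin (n + 1) → ℝ × A) × (Fin n → ℝ)) → ℝ≥0∞ := fun p => ρ p.2 *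
      M.likelihoodRatio θ₀ θ (p.2.1 (Fin.last n)) (M.f θ₀ (p.2.1 (Fin.last n)) + p.1) with hF
    have mF : Measurable F := by
      have hl : Measurable fun p : ℝ × ((Fin (n + 1) → ℝ × A) × (Fin n → ℝ)) =>
        p.2.1 (Fin.last n) := by fun_prop
      have := measurable_f_apply (M := M) hl θ₀
      fun_prop
    have e1 : ∀ ω, ∏ i ∈ Finset.range n, M.likelihoodRatio θ₀ θ (X i ω) (Y i ω) = ρ (Z ω) := by
      intro ω
      rw [Finset.prod_range]
      rfl
    have e2 : ∀ ω, ∏ i ∈ Finset.range (n + 1), M.likelihoodRatio θ₀ θ (X i ω) (Y i ω)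
        = F (U ω, Z ω) := by
      intro ω
      rw [Finset.prod_range_succ, e1]
      simp only [hF, hU, hZ, Fin.val_last, add_sub_cancel]
    simp only [e1] at ih
    simp only [e2]
    rw [← lintegral_map (f := F) mF (mU.prodMk mZ),
      (indepFun_iff_map_prod_eq_prod_map_map mU.aemeasurable mZ.aemeasurable).1 (h.noise_indep n),
      h.noise_law n, lintegral_prod_symm' _ mF]
    have e3 : ∀ z, ∫⁻ e, F (e, z) ∂(gaussianReal 0 (M.var θ₀)) = ρ z := by
      intro z
      simp only [hF]
      rw [lintegral_const_mul _ (by fun_prop), lintegral_likelihoodRatio, mul_one]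
    simp only [e3]
    rw [lintegral_map mρ mZ, ih]

/-- The evidence is the finite likelihood at `θ₀` times the prior mean of the likelihood ratio,
which has expectation one by Tonelli. No prior mass near `θ₀` is required. -/
lemma ae_evidence_data_ne_top (h : M.IsTrueModel θ₀ P X Y) (prior : Measure Θ)
    [IsProbabilityMeasure prior] (n : ℕ) :
    ∀ᵐ ω ∂P, ∫⁻ θ, ∏ i ∈ Finset.range n, M.likelihood (X i ω) (Y i ω) θ ∂prior ≠ ∞ := by
  have hX := h.measurable_X
  have hY := h.measurable_Y
  have hm : Measurable (fun p : Ω × Θ =>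
      ∏ i ∈ Finset.range n, M.likelihoodRatio θ₀ p.2 (X i p.1) (Y i p.1)) := by
    fun_prop
  have hint : ∫⁻ ω, ∫⁻ θ, ∏ i ∈ Finset.range n, M.likelihoodRatio θ₀ θ (X i ω) (Y i ω) ∂prior ∂P
      = 1 := by
    rw [lintegral_lintegral_swap hm.aemeasurable]
    simp [lintegral_prod_likelihoodRatio h]
  filter_upwards [ae_lt_top hm.lintegral_prod_right' (by rw [hint]; simp)] with ω hω
  have e : ∀ θ, ∏ i ∈ Finset.range n, M.likelihood (X i ω) (Y i ω) θ
      = (∏ i ∈ Finset.range n, M.likelihood (X i ω) (Y i ω) θ₀) *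
        ∏ i ∈ Finset.range n, M.likelihoodRatio θ₀ θ (X i ω) (Y i ω) := by
    intro θ
    rw [← Finset.prod_mul_distrib]
    refine Finset.prod_congr rfl fun i _ => ?_
    rw [likelihoodRatio, ENNReal.mul_div_cancel (M.likelihood_ne_zero _ _ _)
      (M.likelihood_ne_top _ _ _)]
  rw [lintegral_congr e, lintegral_const_mul _ (by fun_prop)]
  exact ENNReal.mul_ne_top (ENNReal.prod_ne_top fun i _ => M.likelihood_ne_top _ _ _) hω.ne

lemma ae_posterior_eq (h : M.IsTrueModel θ₀ P X Y) (prior : Measure Θ)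
    [IsProbabilityMeasure prior] (n : ℕ) :
    ∀ᵐ ω ∂P, ∃ g, IsDensity prior g ∧
      M.posterior prior (fun i => X i ω) (fun i => Y i ω) n = prior.withDensity g := by
  filter_upwards [ae_evidence_data_ne_top h prior n] with ω hω
  have hm : Measurable fun θ => ∏ i ∈ Finset.range n, M.likelihood (X i ω) (Y i ω) θ := by
    fun_prop
  have h0 : ∫⁻ θ, ∏ i ∈ Finset.range n, M.likelihood (X i ω) (Y i ω) θ ∂prior ≠ 0 := by
    rw [Ne, lintegral_eq_zero_iff hm]
    intro h
    obtain ⟨θ, hθ⟩ := h.exists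
    exact Finset.prod_ne_zero_iff.2 (fun i _ => M.likelihood_ne_zero _ _ _) hθ
  refine ⟨_, isDensity_normalize hm, ?_⟩
  rw [normalize_of_ne h0 hω]
  exact (withDensity_smul _ hm).symm

end Data

/-! ### From sequences of beliefs to convergence in probability -/

section Final

variable {Θ : Type*} [MetricSpace Θ] [MeasurableSpace Θ] [BorelSpace Θ]
  {M : Dynamics A Θ} {μ : Measure Θ} {r : ℝ → A → ℝ} {η γ R : ℝ} {C : ℝ≥0} {θ₀ : Θ}

/-- The cut-off distance is at most `δ` plus the indicator of `δ < dist θ θ₀`. -/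
lemma dispersion_lt_of_measureReal_lt {b : Measure Θ} [IsProbabilityMeasure b] {δ : ℝ}
    (h : b.real {θ | δ < dist θ θ₀} < δ) :
    dispersion b θ₀ < ENNReal.ofReal δ + ENNReal.ofReal δ := by
  have hS : MeasurableSet {θ : Θ | δ < dist θ θ₀} := measurableSet_lt measurable_const (by fun_prop)
  have hlt : b {θ | δ < dist θ θ₀} < ENNReal.ofReal δ :=
    (ENNReal.lt_ofReal_iff_toReal_lt (measure_ne_top _ _)).2 h
  calc dispersion b θ₀
      ≤ ∫⁻ θ, (ENNReal.ofReal δ + {θ | δ < dist θ θ₀}.indicator 1 θ) ∂b := by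
        refine lintegral_mono fun θ => ?_
        by_cases hθ : δ < dist θ θ₀
        · rw [Set.indicator_of_mem (show θ ∈ {θ | δ < dist θ θ₀} from hθ)]
          exact (min_le_left _ _).trans le_add_self
        · refine (min_le_right _ _).trans (le_trans ?_ le_self_add)
          rw [edist_dist]
          exact ENNReal.ofReal_le_ofReal (not_lt.1 hθ)
    _ = ENNReal.ofReal δ + b {θ | δ < dist θ θ₀} := by
        rw [lintegral_add_left measurable_const, lintegral_indicator_one hS]
        simp
    _ < _ := (ENNReal.add_lt_add_iff_left ENNReal.ofReal_ne_top).2 hlt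

/-- Counterexamples for `δ = 1 / (n + 1)` would form a concentrating sequence contradicting
`tendsto_Vaugm`. The modulus is uniform over densities, hence over the random posterior. -/
lemma exists_dispersion_bound (h : M.BoundedReward μ r η γ R C) [Nonempty A]
    [IsProbabilityMeasure μ] (hA : IsCompact A)
    (hf : ContinuousAt M.f θ₀) (hvar : ContinuousAt M.var θ₀) (t : ℕ) (s : ℝ) {ε : ℝ}
    (hε : 0 < ε) : ∃ δ : ℝ, 0 < δ ∧ ∀ g : Θ → ℝ≥0∞, IsDensity μ g →
      dispersion (μ.withDensity g) θ₀ < ENNReal.ofReal δ + ENNReal.ofReal δ →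
      dist (M.Vaugm r η γ t s (μ.withDensity g)) (M.Vstar r γ θ₀ t s) < ε := by
  by_contra! hcon
  choose g hg hlt hle using fun n : ℕ => hcon (1 / ((n : ℝ) + 1)) (by positivity)
  have h0 : Tendsto (fun n : ℕ => ENNReal.ofReal (1 / ((n : ℝ) + 1))) atTop (𝓝 0) := by
    simpa using ENNReal.tendsto_ofReal tendsto_one_div_add_atTop_nhds_zero_nat
  have hb : Tendsto (fun n => dispersion (μ.withDensity (g n)) θ₀) atTop (𝓝 0) :=
    tendsto_of_tendsto_of_tendsto_of_le_of_le tendsto_const_nhds (by simpa using h0.add h0)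
      (fun _ => zero_le) fun n => (hlt n).le
  obtain ⟨n, hn⟩ := ((tendsto_Vaugm h hA hf hvar t s g hg hb).eventually
    (Metric.ball_mem_nhds _ hε)).exists
  exact absurd hn (not_lt.2 (hle n))

end Final

end Dynamics

end BayesRL

end

theorem mainTheorem3
    {A : Set ℝ} (hA : IsCompact A) (hA' : A.Nonempty)
    {Θ : Type*} [MetricSpace Θ] [MeasurableSpace Θ] [BorelSpace Θ]
    (M : BayesRL.Dynamics A Θ) (θ₀ : Θ)
    (hf : ContinuousAt M.f θ₀) (hvar : ContinuousAt M.var θ₀)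
    (prior : Measure Θ) [IsProbabilityMeasure prior]
    (r : ℝ → A → ℝ) (hr : Measurable (fun p : ℝ × A => r p.1 p.2))
    (hrcont : ∀ s, Continuous (r s)) (η γ : ℝ) (hη : 0 ≤ η) (hγ : 0 < γ) (hγ' : γ < 1)
    -- the combined reward is bounded on hyper-states
    (hrbdd : ∃ C : ℝ, ∀ s a, |r s a| ≤ C)
    (hIGbdd : ∃ C : ℝ≥0, ∀ b : Measure Θ, IsProbabilityMeasure b → b ≪ prior →
      ∀ s a, ENNReal.ofReal η * M.infoGain b s a ≤ C)
    {Ω : Type*} [MeasurableSpace Ω] (P : Measure Ω) [IsProbabilityMeasure P]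
    (X : ℕ → Ω → ℝ × A) (Y : ℕ → Ω → ℝ) (hdata : M.IsTrueModel θ₀ P X Y)
    -- weak posterior consistency at the true parameter
    (hcons : ∀ ε : ℝ, 0 < ε → TendstoInMeasure P
      (fun n ω => (M.posterior prior (fun i => X i ω) (fun i => Y i ω) n).real
        {θ | ε < dist θ θ₀}) atTop (fun _ => 0)) :
    ∀ (t : ℕ) (s : ℝ), TendstoInMeasure P
      (fun n ω => M.Vaugm r η γ t s (M.posterior prior (fun i => X i ω) (fun i => Y i ω) n))
      atTop (fun _ => M.Vstar r γ θ₀ t s) := by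
  intro t s
  obtain ⟨R, hR⟩ := hrbdd
  obtain ⟨C, hC⟩ := hIGbdd
  have : Nonempty A := hA'.to_subtype
  have hreg : M.BoundedReward prior r η γ R C := ⟨hr, hrcont, hη, hγ.le, hR, hC⟩
  rw [tendstoInMeasure_iff_dist]
  intro ε hε
  obtain ⟨δ, hδ, hbound⟩ := BayesRL.Dynamics.exists_dispersion_bound hreg hA hf hvar t s hε
  -- Consistency is used with `δ` as both radius and mass threshold. Up to a null set, an
  -- `ε`-deviation of the value forces far mass at least `δ`.
  refine tendsto_of_tendsto_of_tendsto_of_le_of_le tendsto_const_nhds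
    (tendstoInMeasure_iff_dist.1 (hcons δ hδ) δ hδ) (fun _ => zero_le)
    fun n => measure_mono_ae ?_
  filter_upwards [BayesRL.Dynamics.ae_posterior_eq hdata prior n] with ω hω hle
  obtain ⟨g, hg, heq⟩ := hω
  have := hg.isProbabilityMeasure
  change ε ≤ dist _ _ at hle
  change δ ≤ dist _ _
  rw [heq] at hle ⊢
  by_contra hlt
  rw [Real.dist_0_eq_abs, abs_of_nonneg measureReal_nonneg, not_le] at hlt
  exact absurd (hbound g hg (BayesRL.Dynamics.dispersion_lt_of_measureReal_lt hlt))
    (not_lt.2 hle)
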